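/- Let $\mu>0$ and $\gamma>0$. Two point masses at heights $x(t)$ and $y(t)$ on a vertical line, joined by a damped spring, move above a floor at height $0$ which constrains only the lower mass: $x(t)\ge 0$. As long as $x>0$, $$\ddot x+\mu\dot x+\tfrac12 x=-\gamma-\tfrac12+\tfrac12 y+\mu\dot y,\qquad \ddot y+\mu\dot y+\tfrac12 y=-\gamma+\tfrac12+\tfrac12 x+\mu\dot x .$$ The functions $x$, $y$, $\dot y$ are continuous, and at every time $t$ with $x(t)=0$ the lower mass is reflected elastically, $\dot x(t^+)=-\dot x(t^-)$. If $x=\dot x=0$ at some time and the force $F=\tfrac12y+\mu\dot y-\gamma-\tfrac12$ on the lower mass satisfies $F<0$, or $F=0$ and $\dot F\le 0$ (where $\dot F=\tfrac12\dot y+\mu\ddot y$), then the lower mass stays at rest on the floor, $x=0$, while $\ddot y+\mu\dot y+\tfrac12y=-\gamma+\tfrac12$, until the first time at which $F=0$ and $\dot F>0$; from every other state the ball enters free flight. A motion on $[0,T)$, $0<T\le\infty$, is a solution of these rules in which the changes between flight and contact (impacts, grazings, beginnings and ends of persistent contacts) do not accumulate at any time before $T$. The initial condition consists of $x(0)\ge0$,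 $\dot x(0)$, $y(0)$, $\dot y(0)$ (if $x(0)=0$ and $\dot x(0)<0$, an impact takes place at time $0$). The system has exactly one static equilibrium (a state with $x\ge0$ that gives rise to a constant motion), namely $x=\dot x=\dot y=0$, $y=1-2\gamma$. Starting from any initial condition with $x(0)\ge 0$, the motion exists for all times $t\ge0$ (in particular there is no accumulation of impacts at a finite time), it is unique (every motion on any $[0,T)$ with the same initial condition is a restriction of it), and it tends to the static equilibrium: $$\lim_{t\to\infty}x(t)=\lim_{t\to\infty}\dot x(t)=\lim_{t\to\infty}\dot y(t)=0,\qquad \lim_{t\to\infty}y(t)=1-2\gamma .$$ -/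

import Mathlib

open Filter Topology

/-- A state of the ball: position `x` and velocity `vx` of the lower point mass,
position `y` and velocity `vy` of the upper point mass (dimensionless units). -/
@[ext]
structure BallState where
  x : ℝ
  vx : ℝ
  y : ℝ
  vy : ℝ

namespace BallState

/-- Acceleration of the lower mass when it is not in contact with the floor. -/
noncomputable def lowerAccel (μ γ : ℝ) (u : BallState) : ℝ :=
  -γ - 1 / 2 + u.y / 2 + μ * u.vy - μ * u.vx - u.x / 2

/-- Acceleration of the upper mass. It only feels gravity and the spring, so the formula is the
same in flight and (with `x = vx = 0`) while the lower mass rests on the floor. -/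
noncomputable def upperAccel (μ γ : ℝ) (u : BallState) : ℝ :=
  -γ + 1 / 2 + u.x / 2 + μ * u.vx - u.y / 2 - μ * u.vy

/-- The force `F = y/2 + μ ẏ - γ - 1/2` of spring and gravity on a lower mass that rests on
the floor. -/
noncomputable def contactForce (μ γ : ℝ) (u : BallState) : ℝ :=
  u.y / 2 + μ * u.vy - γ - 1 / 2

/-- The time derivative `Ḟ = ẏ/2 + μ ÿ` of the contact force. -/
noncomputable def contactForceRate (μ γ : ℝ) (u : BallState) : ℝ :=
  u.vy / 2 + μ * upperAccel μ γ u

/-- The states from which the lower mass stays on the floor: it is on the floor with zero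
velocity, and the force on it is pressing it down (`F < 0`) or vanishes without being about to
become positive (`F = 0`, `Ḟ ≤ 0`). So contact is lost exactly when `F = 0` and `Ḟ > 0`, and a
floor contact with zero velocity and `F > 0` is a grazing. -/
def Sticks (μ γ : ℝ) (u : BallState) : Prop :=
  u.x = 0 ∧ u.vx = 0 ∧
    (contactForce μ γ u < 0 ∨ (contactForce μ γ u = 0 ∧ contactForceRate μ γ u ≤ 0))

/-- The initial state after a possible impact at the initial time: if the lower mass starts on the
floor with a downward velocity, that velocity is reversed. -/
noncomputable def afterImpact (u : BallState) : BallState :=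
  ⟨u.x, if u.x = 0 then |u.vx| else u.vx, u.y, u.vy⟩

end BallState

/-- At time `t` the lower mass is above the floor and the ball obeys the equations of motion of
the free ball. -/
def FlightAt (μ γ : ℝ) (m : ℝ → BallState) (t : ℝ) : Prop :=
  0 < (m t).x ∧
  HasDerivAt (fun s => (m s).x) (m t).vx t ∧
  HasDerivAt (fun s => (m s).vx) ((m t).lowerAccel μ γ) t ∧
  HasDerivAt (fun s => (m s).y) (m t).vy t ∧
  HasDerivAt (fun s => (m s).vy) ((m t).upperAccel μ γ) t

/-- At time `t` the lower mass rests on the floor and the upper mass oscillates on the spring. -/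
def ContactAt (μ γ : ℝ) (m : ℝ → BallState) (t : ℝ) : Prop :=
  (m t).x = 0 ∧ (m t).vx = 0 ∧
  HasDerivAt (fun s => (m s).y) (m t).vy t ∧
  HasDerivAt (fun s => (m s).vy) ((m t).upperAccel μ γ) t

/-- The time interval `[0, T)`, where `T = ⊤` is allowed. -/
def timeDomain (T : EReal) : Set ℝ := {t | 0 ≤ t ∧ (t : EReal) < T}

/-- `m` is a motion of the ball on `[0, T)` with initial state `u₀`. The velocity `(m t).vx` of the
lower mass is taken right-continuous, so at an impact it is the velocity after the impact.
By `right_phase` and `left_phase` every time of `[0, T)` is adjacent only to whole intervals of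
flight or of contact: impacts, grazings, beginnings and ends of persistent contacts may accumulate
at `T` (when `T` is finite this is an inelastic collapse) but at no time before `T`. -/
structure IsMotion (μ γ : ℝ) (T : EReal) (u₀ : BallState) (m : ℝ → BallState) : Prop where
  init : m 0 = u₀.afterImpact
  nonneg : ∀ t ∈ timeDomain T, 0 ≤ (m t).x
  continuous_x : ContinuousOn (fun t => (m t).x) (timeDomain T)
  continuous_y : ContinuousOn (fun t => (m t).y) (timeDomain T)
  continuous_vy : ContinuousOn (fun t => (m t).vy) (timeDomain T)
  right_continuous_vx : ∀ t ∈ timeDomain T,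
    Tendsto (fun s => (m s).vx) (𝓝[>] t) (𝓝 (m t).vx)
  /-- Away from the floor the velocity of the lower mass does not jump. -/
  left_continuous_vx : ∀ t ∈ timeDomain T, 0 < t → 0 < (m t).x →
    Tendsto (fun s => (m s).vx) (𝓝[<] t) (𝓝 (m t).vx)
  /-- Elastic reflection at the floor: `ẋ(t⁺) = -ẋ(t⁻)`. -/
  impact : ∀ t ∈ timeDomain T, 0 < t → (m t).x = 0 →
    Tendsto (fun s => (m s).vx) (𝓝[<] t) (𝓝 (-(m t).vx))
  right_phase : ∀ t ∈ timeDomain T,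
    ((m t).Sticks μ γ ∧ ∀ᶠ s in 𝓝[>] t, ContactAt μ γ m s) ∨
    (¬ (m t).Sticks μ γ ∧ ∀ᶠ s in 𝓝[>] t, FlightAt μ γ m s)
  left_phase : ∀ t ∈ timeDomain T, 0 < t →
    (∀ᶠ s in 𝓝[<] t, ContactAt μ γ m s) ∨ (∀ᶠ s in 𝓝[<] t, FlightAt μ γ m s)

/-- A static equilibrium: a state in which the ball can stay at rest forever. -/
def IsStaticEquilibrium (μ γ : ℝ) (u : BallState) : Prop :=
  IsMotion μ γ ⊤ u (fun _ => u)

/-! Convergence comes from dissipation. The mechanical energy has right derivative `-μ (vy - vx)²`,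
and elastic impacts preserve it because they preserve `vx²`; for `γ > 0` and `x ≥ 0` it bounds the
motion. Since the energy converges, the spring length `y - x` varies arbitrarily little over late
time windows of any fixed length. A bounded function whose derivative varies slowly in this sense
has derivative tending to zero (`tendsto_zero_of_slowly_varying`). Applied to `vy + μ (y - x)` this
gives the limit of the spring length, applied to `y` it gives `vy → 0`. The lower mass cannot stay
high: it would remain in flight for a long time, during which `vx + vy` falls at rate `2γ`, against
boundedness. Finally `vx²` converges by the energy, and a positive limit would cost infinite energy.

The hard point is that phases do not accumulate at a finite time `T` (`IsMotion.phase_end`). The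
lower mass obeys `ẍ + μ ẋ + (1/2 - μ²) x = f`, where the reduced force `f` has a derivative without
`vx`, hence continuous across impacts. If floor contacts occur up to `T`, then `f` has a definite
sign just before `T`; the degenerate case is settled by a derivative tending to `-γ`. If `f > 0`, a
modified velocity increases strictly and forbids further contacts. If `f < 0`, the bounce energy
`vx²/2 + x²/2 - f x` can neither grow nor, relative to `-f`, decay faster than exponentially. Either
it vanishes and the mass has come to rest, or near `T` the force is so weak compared with the impact
speed that the mass does not return before `T`.

Uniqueness is a Gronwall estimate continued by interval induction: the state selects the phase to
its right, and left limits with the impact law determine the state. Existence follows from local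
solutions in each phase, limits at the end of a bounded interval, and gluing by uniqueness. -/

/-! ### One-sided calculus on the real line -/

/-- Induction along a real interval. -/
lemma real_interval_induction {P : ℝ → Prop} {a b : ℝ} (hab : a ≤ b) (h0 : P a)
    (hr : ∀ t, a ≤ t → t < b → (∀ s, a ≤ s → s ≤ t → P s) → ∀ᶠ s in 𝓝[>] t, P s)
    (hl : ∀ t, a < t → t ≤ b → (∀ s, a ≤ s → s < t → P s) → P t) :
    ∀ t, a ≤ t → t ≤ b → P t := by
  set S : Set ℝ := {t | a ≤ t ∧ t ≤ b ∧ ∀ s, a ≤ s → s ≤ t → P s} with hS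
  have haS : a ∈ S := ⟨le_rfl, hab, fun s h1 h2 => by rwa [le_antisymm h2 h1]⟩
  have hbdd : BddAbove S := ⟨b, fun t ht => ht.2.1⟩
  set c := sSup S with hc
  have hac : a ≤ c := le_csSup hbdd haS
  have hcb : c ≤ b := csSup_le ⟨a, haS⟩ fun t ht => ht.2.1
  have hlt : ∀ s, a ≤ s → s < c → P s := by
    intro s h1 h2
    obtain ⟨t, ht, hst⟩ := exists_lt_of_lt_csSup ⟨a, haS⟩ h2
    exact ht.2.2 s h1 hst.le
  have hPc : P c := by
    rcases hac.eq_or_lt with h | h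
    · rwa [← h]
    · exact hl c h hcb hlt
  have hle : ∀ s, a ≤ s → s ≤ c → P s := by
    intro s h1 h2
    rcases h2.eq_or_lt with h | h
    · rwa [h]
    · exact hlt s h1 h
  rcases hcb.eq_or_lt with h | h
  · rw [h] at hle; exact hle
  · exfalso
    have := hr c hac h hle
    obtain ⟨d, hd, hd'⟩ := mem_nhdsGT_iff_exists_Ioo_subset.1 this
    have hd : c < d := hd
    set e := min ((c + d) / 2) b
    have hce : c < e := lt_min (by linarith) h
    have hed : e < d := (min_le_left _ _).trans_lt (by linarith)
    have : e ∈ S := by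
      refine ⟨hac.trans hce.le, min_le_right _ _, fun s h1 h2 => ?_⟩
      rcases le_or_gt s c with h3 | h3
      · exact hle s h1 h3
      · exact hd' ⟨h3, h2.trans_lt hed⟩
    exact absurd (le_csSup hbdd this) (not_le.2 hce)

/-- A function with nonnegative right derivatives, all of whose jumps are upward jumps from the
left limit, is monotone. -/
lemma le_of_rightDeriv_nonneg_of_jumps {φ : ℝ → ℝ} {a b : ℝ} (hab : a ≤ b)
    (hr : ∀ t, a ≤ t → t < b → ∃ d, 0 ≤ d ∧ HasDerivWithinAt φ d (Set.Ici t) t)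
    (hl : ∀ t, a < t → t ≤ b → ∃ l, l ≤ φ t ∧ Tendsto φ (𝓝[<] t) (𝓝 l)) :
    φ a ≤ φ b := by
  -- The slack `ε (b - a)` turns the weak bound on the right derivative into a strict one, which
  -- then holds on a right neighbourhood. It is removed at the end by a choice of `ε` that loses
  -- half of the supposed gap.
  have key : ∀ ε : ℝ, 0 < ε → φ a - ε * (b - a) ≤ φ b := by
    intro ε hε
    refine real_interval_induction (P := fun t => φ a - ε * (t - a) ≤ φ t) hab (by simp) ?_ ?_
      b hab le_rfl
    · intro t h1 h2 h3
      obtain ⟨d, hd, hd'⟩ := hr t h1 h2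
      have h4 := (hasDerivWithinAt_iff_tendsto_slope' (by simp : t ∉ Set.Ioi t)).1
        (hd'.mono Set.Ioi_subset_Ici_self)
      have h5 : ∀ᶠ s in 𝓝[>] t, -ε < slope φ t s := h4.eventually (lt_mem_nhds (by linarith))
      filter_upwards [h5, self_mem_nhdsWithin] with s hs hts
      have hts : t < s := hts
      rw [slope_def_field, lt_div_iff₀ (by linarith)] at hs
      have := h3 t h1 le_rfl
      linarith
    · intro t h1 h2 h3
      obtain ⟨l, hl1, hl2⟩ := hl t h1 h2
      refine le_trans ?_ hl1
      have h6 : Tendsto (fun s => φ a - ε * (s - a)) (𝓝[<] t) (𝓝 (φ a - ε * (t - a))) :=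
        ((by fun_prop : Continuous fun s : ℝ => φ a - ε * (s - a)).tendsto t).mono_left
          nhdsWithin_le_nhds
      refine le_of_tendsto_of_tendsto h6 hl2 ?_
      filter_upwards [Ioo_mem_nhdsLT h1] with s hs using h3 s hs.1.le hs.2
  rcases hab.eq_or_lt with rfl | h
  · exact le_rfl
  by_contra! hcon
  have := key ((φ a - φ b) / (2 * (b - a))) (div_pos (by linarith) (by linarith))
  have h7 : (φ a - φ b) / (2 * (b - a)) * (b - a) = (φ a - φ b) / 2 := by
    field_simp [sub_ne_zero.2 h.ne']
  linarith

lemma le_of_rightDeriv_nonneg {φ : ℝ → ℝ} {a b : ℝ} (hab : a ≤ b)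
    (hr : ∀ t, a ≤ t → t < b → ∃ d, 0 ≤ d ∧ HasDerivWithinAt φ d (Set.Ici t) t)
    (hl : ∀ t, a < t → t ≤ b → ContinuousWithinAt φ (Set.Iio t) t) :
    φ a ≤ φ b :=
  le_of_rightDeriv_nonneg_of_jumps hab hr fun t h1 h2 => ⟨φ t, le_rfl, hl t h1 h2⟩

lemma abs_sub_le_of_rightDeriv {φ φ' : ℝ → ℝ} {a b K : ℝ} (hab : a ≤ b)
    (hr : ∀ t, a ≤ t → t < b → HasDerivWithinAt φ (φ' t) (Set.Ici t) t ∧ |φ' t| ≤ K)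
    (hl : ∀ t, a < t → t ≤ b → ContinuousWithinAt φ (Set.Iio t) t) :
    |φ b - φ a| ≤ K * (b - a) := by
  have hid : ∀ (c : ℝ) (t : ℝ) (s : Set ℝ), HasDerivWithinAt (fun s : ℝ => c * s) c s t := by
    intro c t s; simpa using ((hasDerivWithinAt_id t s).const_mul c)
  have h1 : K * a - φ a ≤ K * b - φ b := by
    refine le_of_rightDeriv_nonneg (φ := fun t => K * t - φ t) hab (fun t h1 h2 => ?_)
      fun t h1 h2 => ?_
    · obtain ⟨h3, h4⟩ := hr t h1 h2
      exact ⟨K - φ' t, by linarith [le_abs_self (φ' t)], (hid K t _).sub h3⟩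
    · exact ContinuousWithinAt.sub (by fun_prop) (hl t h1 h2)
  have h2 : K * a + φ a ≤ K * b + φ b := by
    refine le_of_rightDeriv_nonneg (φ := fun t => K * t + φ t) hab (fun t h1 h2 => ?_)
      fun t h1 h2 => ?_
    · obtain ⟨h3, h4⟩ := hr t h1 h2
      exact ⟨K + φ' t, by linarith [neg_abs_le (φ' t)], (hid K t _).add h3⟩
    · exact ContinuousWithinAt.add (by fun_prop) (hl t h1 h2)
  rw [abs_le]; constructor <;> linarith

/-- The right derivative at a point is the limit of the derivatives from the right. -/
lemma hasDerivWithinAt_Ici_of_eventually {f f' : ℝ → ℝ} {t e : ℝ}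
    (h : ∀ᶠ s in 𝓝[>] t, HasDerivAt f (f' s) s) (hc : Tendsto f (𝓝[>] t) (𝓝 (f t)))
    (hl : Tendsto f' (𝓝[>] t) (𝓝 e)) : HasDerivWithinAt f e (Set.Ici t) t := by
  refine hasDerivWithinAt_Ici_of_tendsto_deriv (s := {s | HasDerivAt f (f' s) s} ∩ Set.Ioi t)
    (fun s hs => hs.1.differentiableAt.differentiableWithinAt) ?_
    (Filter.inter_mem h self_mem_nhdsWithin) ?_
  · exact hc.mono_left (nhdsWithin_mono _ Set.inter_subset_right)
  · refine hl.congr' ?_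
    filter_upwards [h] with s hs using hs.deriv.symm

lemma hasDerivWithinAt_Iic_of_eventually {f f' : ℝ → ℝ} {t e : ℝ}
    (h : ∀ᶠ s in 𝓝[<] t, HasDerivAt f (f' s) s) (hc : Tendsto f (𝓝[<] t) (𝓝 (f t)))
    (hl : Tendsto f' (𝓝[<] t) (𝓝 e)) : HasDerivWithinAt f e (Set.Iic t) t := by
  refine hasDerivWithinAt_Iic_of_tendsto_deriv (s := {s | HasDerivAt f (f' s) s} ∩ Set.Iio t)
    (fun s hs => hs.1.differentiableAt.differentiableWithinAt) ?_
    (Filter.inter_mem h self_mem_nhdsWithin) ?_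
  · exact hc.mono_left (nhdsWithin_mono _ Set.inter_subset_right)
  · refine hl.congr' ?_
    filter_upwards [h] with s hs using hs.deriv.symm

lemma HasDerivWithinAt.hasDerivAt_of_Iic_of_Ici {f : ℝ → ℝ} {t e : ℝ}
    (h1 : HasDerivWithinAt f e (Set.Iic t) t) (h2 : HasDerivWithinAt f e (Set.Ici t) t) :
    HasDerivAt f e t := by
  have := h1.union h2
  rwa [Set.Iic_union_Ici, hasDerivWithinAt_univ] at this

/-- A function that is nonnegative at `t` and has positive derivative to the right of `t` is
positive to the right of `t`. -/
lemma eventually_pos_right_of_deriv {g h : ℝ → ℝ} {t : ℝ} (h0 : 0 ≤ g t)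
    (hd : ∀ᶠ s in 𝓝 t, HasDerivAt g (h s) s) (hp : ∀ᶠ s in 𝓝[>] t, 0 < h s) :
    ∀ᶠ s in 𝓝[>] t, 0 < g s := by
  obtain ⟨b, hb, hb'⟩ := mem_nhdsGT_iff_exists_Ioo_subset.1
    (hp.and (mem_nhdsWithin_of_mem_nhds hd))
  have hb : t < b := hb
  filter_upwards [Ioo_mem_nhdsGT hb] with s hs
  have hmono : StrictMonoOn g (Set.Icc t s) := by
    refine strictMonoOn_of_deriv_pos (convex_Icc t s) ?_ ?_
    · intro r hr
      rcases hr.1.eq_or_lt with rfl | h1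
      · exact hd.self_of_nhds.continuousAt.continuousWithinAt
      · exact (hb' ⟨h1, hr.2.trans_lt hs.2⟩).2.continuousAt.continuousWithinAt
    · intro r hr
      rw [interior_Icc] at hr
      have := hb' ⟨hr.1, hr.2.trans hs.2⟩
      rw [this.2.deriv]; exact this.1
  exact h0.trans_lt (hmono ⟨le_rfl, hs.1.le⟩ ⟨hs.1.le, le_rfl⟩ hs.1)

/-- A Lipschitz function on `[a, b)` has a limit at `b`. -/
lemma exists_tendsto_left_of_lipschitz {f : ℝ → ℝ} {a b K : ℝ} (hK : 0 ≤ K)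
    (hf : ∀ s t, a ≤ s → s ≤ t → t < b → |f t - f s| ≤ K * (t - s)) (hab : a < b) :
    ∃ l, Tendsto f (𝓝[<] b) (𝓝 l) := by
  have hL : LipschitzOnWith ⟨K, hK⟩ f (Set.Ico a b) := by
    refine LipschitzOnWith.of_dist_le_mul fun s hs t ht => ?_
    rw [Real.dist_eq, Real.dist_eq]
    change |f s - f t| ≤ K * |s - t|
    rcases le_total s t with h | h
    · rw [abs_sub_comm, abs_sub_comm s t, abs_of_nonneg (sub_nonneg.2 h)]
      exact hf s t hs.1 h ht.2
    · rw [abs_of_nonneg (sub_nonneg.2 h)]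
      exact hf t s ht.1 h hs.2
  obtain ⟨g, hg, hfg⟩ := hL.extend_real
  refine ⟨g b, ((hg.continuous.tendsto b).mono_left nhdsWithin_le_nhds).congr' ?_⟩
  filter_upwards [Ioo_mem_nhdsLT hab] with s hs using (hfg ⟨hs.1.le, hs.2⟩).symm

/-! ### Motions described by their one-sided germs -/

/-- The conditions that a motion imposes on its germ to the right of a time. -/
structure GermRight (μ γ : ℝ) (m : ℝ → BallState) (t : ℝ) : Prop where
  nonneg : 0 ≤ (m t).x
  x : Tendsto (fun s => (m s).x) (𝓝[>] t) (𝓝 (m t).x)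
  vx : Tendsto (fun s => (m s).vx) (𝓝[>] t) (𝓝 (m t).vx)
  y : Tendsto (fun s => (m s).y) (𝓝[>] t) (𝓝 (m t).y)
  vy : Tendsto (fun s => (m s).vy) (𝓝[>] t) (𝓝 (m t).vy)
  phase : ((m t).Sticks μ γ ∧ ∀ᶠ s in 𝓝[>] t, ContactAt μ γ m s) ∨
    (¬ (m t).Sticks μ γ ∧ ∀ᶠ s in 𝓝[>] t, FlightAt μ γ m s)

/-- The conditions that a motion imposes on its germ to the left of a time. -/
structure GermLeft (μ γ : ℝ) (m : ℝ → BallState) (t : ℝ) : Prop where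
  x : Tendsto (fun s => (m s).x) (𝓝[<] t) (𝓝 (m t).x)
  y : Tendsto (fun s => (m s).y) (𝓝[<] t) (𝓝 (m t).y)
  vy : Tendsto (fun s => (m s).vy) (𝓝[<] t) (𝓝 (m t).vy)
  vx : 0 < (m t).x → Tendsto (fun s => (m s).vx) (𝓝[<] t) (𝓝 (m t).vx)
  impact : (m t).x = 0 → Tendsto (fun s => (m s).vx) (𝓝[<] t) (𝓝 (-(m t).vx))
  phase : (∀ᶠ s in 𝓝[<] t, ContactAt μ γ m s) ∨ (∀ᶠ s in 𝓝[<] t, FlightAt μ γ m s)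

lemma FlightAt.congr {μ γ : ℝ} {m m' : ℝ → BallState} {t : ℝ} (h : FlightAt μ γ m t)
    (he : m' =ᶠ[𝓝 t] m) : FlightAt μ γ m' t := by
  obtain ⟨h1, h2, h3, h4, h5⟩ := h
  unfold FlightAt
  rw [he.eq_of_nhds]
  exact ⟨h1, h2.congr_of_eventuallyEq (he.mono fun s hs => by simp only [hs]),
    h3.congr_of_eventuallyEq (he.mono fun s hs => by simp only [hs]),
    h4.congr_of_eventuallyEq (he.mono fun s hs => by simp only [hs]),
    h5.congr_of_eventuallyEq (he.mono fun s hs => by simp only [hs])⟩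

lemma ContactAt.congr {μ γ : ℝ} {m m' : ℝ → BallState} {t : ℝ} (h : ContactAt μ γ m t)
    (he : m' =ᶠ[𝓝 t] m) : ContactAt μ γ m' t := by
  obtain ⟨h1, h2, h4, h5⟩ := h
  unfold ContactAt
  rw [he.eq_of_nhds]
  exact ⟨h1, h2,
    h4.congr_of_eventuallyEq (he.mono fun s hs => by simp only [hs]),
    h5.congr_of_eventuallyEq (he.mono fun s hs => by simp only [hs])⟩

lemma eventually_nhds_of_nhdsGT {p : ℝ → Prop} {t : ℝ} (h : ∀ᶠ s in 𝓝[>] t, p s) :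
    ∀ᶠ s in 𝓝[>] t, ∀ᶠ r in 𝓝 s, p r := by
  filter_upwards [eventually_eventually_nhdsWithin.2 h, self_mem_nhdsWithin] with s hs hts
  rwa [isOpen_Ioi.nhdsWithin_eq hts] at hs

lemma eventually_nhds_of_nhdsLT {p : ℝ → Prop} {t : ℝ} (h : ∀ᶠ s in 𝓝[<] t, p s) :
    ∀ᶠ s in 𝓝[<] t, ∀ᶠ r in 𝓝 s, p r := by
  filter_upwards [eventually_eventually_nhdsWithin.2 h, self_mem_nhdsWithin] with s hs hts
  rwa [isOpen_Iio.nhdsWithin_eq hts] at hs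

lemma GermRight.congr {μ γ : ℝ} {m m' : ℝ → BallState} {t : ℝ} (h : GermRight μ γ m t)
    (h0 : m' t = m t) (he : m' =ᶠ[𝓝[>] t] m) : GermRight μ γ m' t := by
  have hev := eventually_nhds_of_nhdsGT he
  refine ⟨by rw [h0]; exact h.nonneg, ?_, ?_, ?_, ?_, ?_⟩
  · rw [h0]; exact h.x.congr' (he.mono fun s hs => by simp only [hs])
  · rw [h0]; exact h.vx.congr' (he.mono fun s hs => by simp only [hs])
  · rw [h0]; exact h.y.congr' (he.mono fun s hs => by simp only [hs])
  · rw [h0]; exact h.vy.congr' (he.mono fun s hs => by simp only [hs])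
  · rw [h0]
    refine h.phase.imp (fun h => ⟨h.1, ?_⟩) (fun h => ⟨h.1, ?_⟩)
    · filter_upwards [h.2, hev] with s h1 h2 using h1.congr h2
    · filter_upwards [h.2, hev] with s h1 h2 using h1.congr h2

lemma eventually_contact_congr_left {μ γ : ℝ} {m m' : ℝ → BallState} {t : ℝ}
    (he : m' =ᶠ[𝓝[<] t] m)
    (h : (∀ᶠ s in 𝓝[<] t, ContactAt μ γ m s) ∨ (∀ᶠ s in 𝓝[<] t, FlightAt μ γ m s)) :
    (∀ᶠ s in 𝓝[<] t, ContactAt μ γ m' s) ∨ (∀ᶠ s in 𝓝[<] t, FlightAt μ γ m' s) := by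
  have hev := eventually_nhds_of_nhdsLT he
  refine h.imp (fun h => ?_) (fun h => ?_)
  · filter_upwards [h, hev] with s h1 h2 using h1.congr h2
  · filter_upwards [h, hev] with s h1 h2 using h1.congr h2

lemma GermLeft.congr {μ γ : ℝ} {m m' : ℝ → BallState} {t : ℝ} (h : GermLeft μ γ m t)
    (h0 : m' t = m t) (he : m' =ᶠ[𝓝[<] t] m) : GermLeft μ γ m' t := by
  refine ⟨?_, ?_, ?_, ?_, ?_, eventually_contact_congr_left he h.phase⟩
  · rw [h0]; exact h.x.congr' (he.mono fun s hs => by simp only [hs])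
  · rw [h0]; exact h.y.congr' (he.mono fun s hs => by simp only [hs])
  · rw [h0]; exact h.vy.congr' (he.mono fun s hs => by simp only [hs])
  · rw [h0]; exact fun hx => (h.vx hx).congr' (he.mono fun s hs => by simp only [hs])
  · rw [h0]; exact fun hx => (h.impact hx).congr' (he.mono fun s hs => by simp only [hs])

lemma FlightAt.continuousAt {μ γ : ℝ} {m : ℝ → BallState} {t : ℝ} (h : FlightAt μ γ m t) :
    ContinuousAt (fun s => (m s).x) t ∧ ContinuousAt (fun s => (m s).vx) t ∧
    ContinuousAt (fun s => (m s).y) t ∧ ContinuousAt (fun s => (m s).vy) t :=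
  ⟨h.2.1.continuousAt, h.2.2.1.continuousAt, h.2.2.2.1.continuousAt, h.2.2.2.2.continuousAt⟩

lemma germs_of_eventually_flight {μ γ : ℝ} {m : ℝ → BallState} {t : ℝ}
    (h : ∀ᶠ s in 𝓝 t, FlightAt μ γ m s) : GermRight μ γ m t ∧ GermLeft μ γ m t := by
  obtain ⟨h1, h2, h3, h4⟩ := h.self_of_nhds.continuousAt
  have hx := h.self_of_nhds.1
  refine ⟨⟨hx.le, ?_, ?_, ?_, ?_, Or.inr ⟨fun hs => hx.ne' hs.1, ?_⟩⟩,
    ⟨?_, ?_, ?_, fun _ => ?_, fun h0 => absurd h0 hx.ne', Or.inr ?_⟩⟩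
  all_goals first
    | exact h1.mono_left nhdsWithin_le_nhds
    | exact h2.mono_left nhdsWithin_le_nhds
    | exact h3.mono_left nhdsWithin_le_nhds
    | exact h4.mono_left nhdsWithin_le_nhds
    | exact mem_nhdsWithin_of_mem_nhds h

/-- Contact on both sides of `t` does not fix the phase rule at `t`, which refers to the force;
hence the separate hypothesis that the state sticks. The impact law is trivial here because `vx =
0`. -/
lemma germs_of_eventually_contact {μ γ : ℝ} {m : ℝ → BallState} {t : ℝ}
    (h : ∀ᶠ s in 𝓝 t, ContactAt μ γ m s) (hs : (m t).Sticks μ γ) :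
    GermRight μ γ m t ∧ GermLeft μ γ m t := by
  have h1 : Tendsto (fun s => (m s).x) (𝓝 t) (𝓝 (m t).x) := by
    rw [hs.1]
    exact tendsto_const_nhds.congr' (h.mono fun s hs => hs.1.symm)
  have h2 : Tendsto (fun s => (m s).vx) (𝓝 t) (𝓝 (m t).vx) := by
    rw [hs.2.1]
    exact tendsto_const_nhds.congr' (h.mono fun s hs => hs.2.1.symm)
  have h3 := h.self_of_nhds.2.2.1.continuousAt
  have h4 := h.self_of_nhds.2.2.2.continuousAt
  refine ⟨⟨hs.1.ge, ?_, ?_, ?_, ?_, Or.inl ⟨hs, ?_⟩⟩,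
    ⟨?_, ?_, ?_, fun h0 => absurd hs.1 h0.ne', fun h0 => ?_, Or.inl ?_⟩⟩
  all_goals first
    | exact h1.mono_left nhdsWithin_le_nhds
    | exact h2.mono_left nhdsWithin_le_nhds
    | exact h3.mono_left nhdsWithin_le_nhds
    | exact h4.mono_left nhdsWithin_le_nhds
    | exact mem_nhdsWithin_of_mem_nhds h
    | skip
  rw [hs.2.1, neg_zero, ← hs.2.1]
  exact h2.mono_left nhdsWithin_le_nhds

lemma exists_real_btwn_of_mem_timeDomain {T : EReal} {t : ℝ} (ht : t ∈ timeDomain T) :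
    ∃ b : ℝ, t < b ∧ ∀ s, 0 ≤ s → s ≤ b → s ∈ timeDomain T := by
  obtain ⟨b, hb, hb'⟩ := EReal.lt_iff_exists_real_btwn.1 ht.2
  exact ⟨b, EReal.coe_lt_coe_iff.1 hb, fun s h1 h2 =>
    ⟨h1, (EReal.coe_le_coe_iff.2 h2).trans_lt hb'⟩⟩

lemma mem_timeDomain_of_le {T : EReal} {s t : ℝ} (ht : t ∈ timeDomain T) (h0 : 0 ≤ s)
    (h : s ≤ t) : s ∈ timeDomain T :=
  ⟨h0, (EReal.coe_le_coe_iff.2 h).trans_lt ht.2⟩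

lemma mem_timeDomain_coe {T t : ℝ} : t ∈ timeDomain (T : EReal) ↔ 0 ≤ t ∧ t < T := by
  simp [timeDomain]

lemma timeDomain_mem_nhdsGT {T : EReal} {t : ℝ} (ht : t ∈ timeDomain T) :
    timeDomain T ∈ 𝓝[>] t := by
  obtain ⟨b, hb, hb'⟩ := exists_real_btwn_of_mem_timeDomain ht
  filter_upwards [Ioo_mem_nhdsGT hb] with s hs using hb' s (ht.1.trans hs.1.le) hs.2.le

lemma timeDomain_mem_nhdsLT {T : EReal} {t : ℝ} (ht : t ∈ timeDomain T) (h0 : 0 < t) :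
    timeDomain T ∈ 𝓝[<] t := by
  filter_upwards [Ioo_mem_nhdsLT h0] with s hs using mem_timeDomain_of_le ht hs.1.le hs.2.le

lemma continuousOn_timeDomain_iff {T : EReal} {f : ℝ → ℝ} :
    ContinuousOn f (timeDomain T) ↔ ∀ t ∈ timeDomain T, Tendsto f (𝓝[>] t) (𝓝 (f t)) ∧
      (0 < t → Tendsto f (𝓝[<] t) (𝓝 (f t))) := by
  constructor
  · intro h t ht
    refine ⟨(h t ht).mono_left ?_, fun h0 => (h t ht).mono_left ?_⟩
    · exact nhdsWithin_le_of_mem (timeDomain_mem_nhdsGT ht)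
    · exact nhdsWithin_le_of_mem (timeDomain_mem_nhdsLT ht h0)
  · intro h t ht
    obtain ⟨h1, h2⟩ := h t ht
    have h1' : ContinuousWithinAt f (Set.Ici t) t := continuousWithinAt_Ioi_iff_Ici.1 h1
    rcases ht.1.eq_or_lt with h0 | h0
    · exact h1'.mono fun s hs => by rw [← h0]; exact hs.1
    · have h2' : ContinuousWithinAt f (Set.Iic t) t := continuousWithinAt_Iio_iff_Iic.1 (h2 h0)
      have := h2'.union h1'
      rw [Set.Iic_union_Ici] at this
      exact this.mono (Set.subset_univ _)

/-- A motion is a function all of whose germs are admissible. -/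
lemma isMotion_iff_germs {μ γ : ℝ} {T : EReal} {u : BallState} {m : ℝ → BallState} :
    IsMotion μ γ T u m ↔ m 0 = u.afterImpact ∧ ∀ t ∈ timeDomain T,
      GermRight μ γ m t ∧ (0 < t → GermLeft μ γ m t) := by
  constructor
  · intro h
    have hx := continuousOn_timeDomain_iff.1 h.continuous_x
    have hy := continuousOn_timeDomain_iff.1 h.continuous_y
    have hvy := continuousOn_timeDomain_iff.1 h.continuous_vy
    exact ⟨h.init, fun t ht => ⟨⟨h.nonneg t ht, (hx t ht).1, h.right_continuous_vx t ht,
      (hy t ht).1, (hvy t ht).1, h.right_phase t ht⟩, fun h0 => ⟨(hx t ht).2 h0, (hy t ht).2 h0,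
      (hvy t ht).2 h0, h.left_continuous_vx t ht h0, h.impact t ht h0, h.left_phase t ht h0⟩⟩⟩
  · rintro ⟨h0, h⟩
    exact ⟨h0, fun t ht => (h t ht).1.nonneg,
      continuousOn_timeDomain_iff.2 fun t ht => ⟨(h t ht).1.x, fun h0 => ((h t ht).2 h0).x⟩,
      continuousOn_timeDomain_iff.2 fun t ht => ⟨(h t ht).1.y, fun h0 => ((h t ht).2 h0).y⟩,
      continuousOn_timeDomain_iff.2 fun t ht => ⟨(h t ht).1.vy, fun h0 => ((h t ht).2 h0).vy⟩,
      fun t ht => (h t ht).1.vx, fun t ht h0 => ((h t ht).2 h0).vx,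
      fun t ht h0 => ((h t ht).2 h0).impact, fun t ht => (h t ht).1.phase,
      fun t ht h0 => ((h t ht).2 h0).phase⟩

lemma IsMotion.germRight {μ γ : ℝ} {T : EReal} {u : BallState} {m : ℝ → BallState}
    (h : IsMotion μ γ T u m) {t : ℝ} (ht : t ∈ timeDomain T) : GermRight μ γ m t :=
  ((isMotion_iff_germs.1 h).2 t ht).1

lemma IsMotion.germLeft {μ γ : ℝ} {T : EReal} {u : BallState} {m : ℝ → BallState}
    (h : IsMotion μ γ T u m) {t : ℝ} (ht : t ∈ timeDomain T) (h0 : 0 < t) : GermLeft μ γ m t :=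
  ((isMotion_iff_germs.1 h).2 t ht).2 h0

/-! ### Uniqueness -/

/-- The squared distance of two states. -/
noncomputable def BallState.sqDist (u v : BallState) : ℝ :=
  (u.x - v.x) ^ 2 + (u.vx - v.vx) ^ 2 + (u.y - v.y) ^ 2 + (u.vy - v.vy) ^ 2

lemma BallState.eq_of_sqDist_le_zero {u v : BallState} (h : u.sqDist v ≤ 0) : u = v := by
  unfold BallState.sqDist at h
  have h1 := sq_nonneg (u.x - v.x)
  have h2 := sq_nonneg (u.vx - v.vx)
  have h3 := sq_nonneg (u.y - v.y)
  have h4 := sq_nonneg (u.vy - v.vy)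
  ext
  · exact sub_eq_zero.1 (pow_eq_zero_iff two_ne_zero |>.1 (by linarith))
  · exact sub_eq_zero.1 (pow_eq_zero_iff two_ne_zero |>.1 (by linarith))
  · exact sub_eq_zero.1 (pow_eq_zero_iff two_ne_zero |>.1 (by linarith))
  · exact sub_eq_zero.1 (pow_eq_zero_iff two_ne_zero |>.1 (by linarith))

/-- Gronwall's argument with rate 1: `exp (-s)` times the squared distance is nonincreasing and
starts at zero. -/
lemma eqOn_right_of_sqDist_deriv {m m' : ℝ → BallState} {t b : ℝ} (h0 : m t = m' t)
    (hc : ContinuousWithinAt (fun s => (m s).sqDist (m' s)) (Set.Ici t) t)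
    (hd : ∀ s ∈ Set.Ioo t b, ∃ d, d ≤ (m s).sqDist (m' s) ∧
      HasDerivAt (fun s => (m s).sqDist (m' s)) d s) :
    ∀ s ∈ Set.Ioo t b, m s = m' s := by
  intro s hs
  have hexp : ∀ r : ℝ, HasDerivAt (fun r : ℝ => Real.exp (-r)) (-Real.exp (-r)) r := by
    intro r; simpa using (hasDerivAt_neg r).exp
  have hanti : AntitoneOn (fun s => Real.exp (-s) * (m s).sqDist (m' s)) (Set.Icc t s) := by
    refine antitoneOn_of_deriv_nonpos (convex_Icc t s) ?_ ?_ ?_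
    · intro r hr
      refine ContinuousWithinAt.mul (by fun_prop) ?_
      rcases hr.1.eq_or_lt with rfl | h1
      · exact hc.mono fun q hq => hq.1
      · obtain ⟨d, -, hd⟩ := hd r ⟨h1, hr.2.trans_lt hs.2⟩
        exact hd.continuousAt.continuousWithinAt
    · intro r hr
      rw [interior_Icc] at hr
      obtain ⟨d, -, hd⟩ := hd r ⟨hr.1, hr.2.trans hs.2⟩
      exact ((hexp r).mul hd).differentiableAt.differentiableWithinAt
    · intro r hr
      rw [interior_Icc] at hr
      obtain ⟨d, hle, hd⟩ := hd r ⟨hr.1, hr.2.trans hs.2⟩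
      have he : HasDerivAt (fun s => Real.exp (-s) * (m s).sqDist (m' s)) _ r := (hexp r).mul hd
      rw [he.deriv]
      nlinarith [Real.exp_pos (-r)]
  have h1 := hanti ⟨le_rfl, hs.1.le⟩ ⟨hs.1.le, le_rfl⟩ hs.1.le
  have h2 : (m t).sqDist (m' t) = 0 := by rw [h0]; simp [BallState.sqDist]
  simp only [h2, mul_zero] at h1
  refine BallState.eq_of_sqDist_le_zero ?_
  by_contra! hcon
  exact absurd h1 (not_le.2 (mul_pos (Real.exp_pos _) hcon))

/-- Whether a state sticks depends on the state alone, so both motions enter the same phase. There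
the equations are linear up to constants and the damping only decreases the squared distance, so the
Gronwall rate 1 suffices for every `μ > 0`. -/
lemma GermRight.eventuallyEq {μ γ : ℝ} (hμ : 0 < μ) {m m' : ℝ → BallState} {t : ℝ}
    (h : GermRight μ γ m t) (h' : GermRight μ γ m' t) (h0 : m t = m' t) :
    ∀ᶠ s in 𝓝[>] t, m s = m' s := by
  have hc : ContinuousWithinAt (fun s => (m s).sqDist (m' s)) (Set.Ici t) t := by
    rw [← continuousWithinAt_Ioi_iff_Ici]
    exact ((((h.x.sub h'.x).pow 2).add ((h.vx.sub h'.vx).pow 2)).add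
      ((h.y.sub h'.y).pow 2)).add ((h.vy.sub h'.vy).pow 2)
  suffices hd : ∀ᶠ s in 𝓝[>] t, ∃ d, d ≤ (m s).sqDist (m' s) ∧
      HasDerivAt (fun s => (m s).sqDist (m' s)) d s by
    obtain ⟨b, hb, hb'⟩ := mem_nhdsGT_iff_exists_Ioo_subset.1 hd
    filter_upwards [Ioo_mem_nhdsGT hb] with s hs
    exact eqOn_right_of_sqDist_deriv h0 hc (fun r hr => hb' hr) s hs
  rcases h.phase with ⟨hs, hp⟩ | ⟨hs, hp⟩
  · rcases h'.phase with ⟨hs', hp'⟩ | ⟨hs', hp'⟩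
    · filter_upwards [hp, hp', eventually_nhds_of_nhdsGT hp, eventually_nhds_of_nhdsGT hp']
        with s h1 h2 h3 h4
      refine ⟨2 * ((m s).y - (m' s).y) * ((m s).vy - (m' s).vy) +
        2 * ((m s).vy - (m' s).vy) * ((m s).upperAccel μ γ - (m' s).upperAccel μ γ), ?_, ?_⟩
      · simp only [BallState.sqDist, BallState.upperAccel, h1.1, h2.1, h1.2.1, h2.2.1]
        nlinarith [mul_nonneg hμ.le (sq_nonneg ((m s).vy - (m' s).vy)),
          sq_nonneg ((m s).vy - (m' s).vy - ((m s).y - (m' s).y))]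
      · have h5 := ((h1.2.2.1.sub h2.2.2.1).pow 2).add ((h1.2.2.2.sub h2.2.2.2).pow 2)
        refine (h5.congr_of_eventuallyEq ?_).congr_deriv ?_
        · filter_upwards [h3, h4] with r h3 h4
          simp [BallState.sqDist, h3.1, h3.2.1, h4.1, h4.2.1]
        · simp
    · exact absurd (h0 ▸ hs) hs'
  · rcases h'.phase with ⟨hs', hp'⟩ | ⟨hs', hp'⟩
    · exact absurd (h0 ▸ hs') hs
    · filter_upwards [hp, hp'] with s h1 h2
      refine ⟨2 * ((m s).x - (m' s).x) * ((m s).vx - (m' s).vx) +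
        2 * ((m s).vx - (m' s).vx) * ((m s).lowerAccel μ γ - (m' s).lowerAccel μ γ) +
        2 * ((m s).y - (m' s).y) * ((m s).vy - (m' s).vy) +
        2 * ((m s).vy - (m' s).vy) * ((m s).upperAccel μ γ - (m' s).upperAccel μ γ), ?_, ?_⟩
      · simp only [BallState.sqDist, BallState.upperAccel, BallState.lowerAccel]
        have e : ∀ a b c d : ℝ, 2 * a * b + 2 * b * (c / 2 + μ * d - μ * b - a / 2) + 2 * c * d +
            2 * d * (a / 2 + μ * b - c / 2 - μ * d) ≤ a ^ 2 + b ^ 2 + c ^ 2 + d ^ 2 := by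
          intro a b c d
          nlinarith [mul_nonneg hμ.le (sq_nonneg (b - d)), sq_nonneg (a + c - (b + d)),
            sq_nonneg (a - c), sq_nonneg (b - d)]
        have := e ((m s).x - (m' s).x) ((m s).vx - (m' s).vx) ((m s).y - (m' s).y)
          ((m s).vy - (m' s).vy)
        linear_combination this
      · have h5 := ((((h1.2.1.sub h2.2.1).pow 2).add ((h1.2.2.1.sub h2.2.2.1).pow 2)).add
          ((h1.2.2.2.1.sub h2.2.2.2.1).pow 2)).add ((h1.2.2.2.2.sub h2.2.2.2.2).pow 2)
        exact h5.congr_deriv (by simp)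

/-- Positions and `vy` are left limits of themselves. The velocity `vx` is its left limit above the
floor and minus its left limit on the floor, so it is determined too. -/
lemma GermLeft.eq {μ γ : ℝ} {m m' : ℝ → BallState} {t : ℝ} (h : GermLeft μ γ m t)
    (h' : GermLeft μ γ m' t) (hm : 0 ≤ (m t).x) (he : ∀ᶠ s in 𝓝[<] t, m s = m' s) :
    m t = m' t := by
  have hx : (m t).x = (m' t).x :=
    tendsto_nhds_unique (h.x.congr' (he.mono fun s hs => by simp only [hs])) h'.x
  have hy : (m t).y = (m' t).y :=
    tendsto_nhds_unique (h.y.congr' (he.mono fun s hs => by simp only [hs])) h'.y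
  have hvy : (m t).vy = (m' t).vy :=
    tendsto_nhds_unique (h.vy.congr' (he.mono fun s hs => by simp only [hs])) h'.vy
  have hvx : (m t).vx = (m' t).vx := by
    rcases hm.eq_or_lt with h0 | h0
    · exact neg_injective (tendsto_nhds_unique
        ((h.impact h0.symm).congr' (he.mono fun s hs => by simp only [hs]))
        (h'.impact (hx ▸ h0.symm)))
    · exact tendsto_nhds_unique ((h.vx h0).congr' (he.mono fun s hs => by simp only [hs]))
        (h'.vx (hx ▸ h0))
  ext <;> assumption

/-- Two motions with the same initial state agree on their common domain. -/
lemma IsMotion.eq {μ γ : ℝ} (hμ : 0 < μ) {T T' : EReal} {u : BallState} {m m' : ℝ → BallState}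
    (h : IsMotion μ γ T u m) (h' : IsMotion μ γ T' u m') {t : ℝ} (ht : t ∈ timeDomain T)
    (ht' : t ∈ timeDomain T') : m t = m' t := by
  refine real_interval_induction (P := fun t => m t = m' t) ht.1 (h.init.trans h'.init.symm)
    ?_ ?_ t ht.1 le_rfl
  · intro s h1 h2 h3
    exact (h.germRight (mem_timeDomain_of_le ht h1 h2.le)).eventuallyEq hμ
      (h'.germRight (mem_timeDomain_of_le ht' h1 h2.le)) (h3 s h1 le_rfl)
  · intro s h1 h2 h3
    refine (h.germLeft (mem_timeDomain_of_le ht h1.le h2) h1).eq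
      (h'.germLeft (mem_timeDomain_of_le ht' h1.le h2) h1)
      (h.nonneg s (mem_timeDomain_of_le ht h1.le h2)) ?_
    filter_upwards [Ioo_mem_nhdsLT h1] with r hr using h3 r hr.1.le hr.2

/-! ### Right derivatives along a motion -/

section RightDerivatives

variable {μ γ : ℝ} {m : ℝ → BallState} {t : ℝ}

lemma GermRight.tendsto_lowerAccel (h : GermRight μ γ m t) :
    Tendsto (fun s => (m s).lowerAccel μ γ) (𝓝[>] t) (𝓝 ((m t).lowerAccel μ γ)) :=
  ((((tendsto_const_nhds).add (h.y.div_const 2)).add (h.vy.const_mul μ)).sub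
    (h.vx.const_mul μ)).sub (h.x.div_const 2)

lemma GermRight.tendsto_upperAccel (h : GermRight μ γ m t) :
    Tendsto (fun s => (m s).upperAccel μ γ) (𝓝[>] t) (𝓝 ((m t).upperAccel μ γ)) :=
  ((((tendsto_const_nhds).add (h.x.div_const 2)).add (h.vx.const_mul μ)).sub
    (h.y.div_const 2)).sub (h.vy.const_mul μ)

lemma GermRight.eventually_contact (h : GermRight μ γ m t) (hs : (m t).Sticks μ γ) :
    ∀ᶠ s in 𝓝[>] t, ContactAt μ γ m s := by
  rcases h.phase with h | h
  · exact h.2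
  · exact absurd hs h.1

lemma GermRight.eventually_flight (h : GermRight μ γ m t) (hs : ¬ (m t).Sticks μ γ) :
    ∀ᶠ s in 𝓝[>] t, FlightAt μ γ m s := by
  rcases h.phase with h | h
  · exact absurd h.1 hs
  · exact h.2

lemma hasDerivWithinAt_Ici_of_eventually_eq_const {f : ℝ → ℝ} {c : ℝ}
    (h : ∀ᶠ s in 𝓝[>] t, f s = c) (h0 : f t = c) : HasDerivWithinAt f 0 (Set.Ici t) t := by
  refine HasDerivWithinAt.Ici_of_Ioi ?_
  exact (hasDerivWithinAt_const t (Set.Ioi t) c).congr_of_eventuallyEq h h0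

lemma GermRight.hasDeriv_x (h : GermRight μ γ m t) :
    HasDerivWithinAt (fun s => (m s).x) (m t).vx (Set.Ici t) t := by
  rcases h.phase with ⟨hs, hp⟩ | ⟨hs, hp⟩
  · rw [hs.2.1]
    exact hasDerivWithinAt_Ici_of_eventually_eq_const (hp.mono fun _ h => h.1) hs.1
  · exact hasDerivWithinAt_Ici_of_eventually (hp.mono fun _ h => h.2.1) h.x h.vx

lemma GermRight.hasDeriv_y (h : GermRight μ γ m t) :
    HasDerivWithinAt (fun s => (m s).y) (m t).vy (Set.Ici t) t := by
  rcases h.phase with ⟨hs, hp⟩ | ⟨hs, hp⟩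
  · exact hasDerivWithinAt_Ici_of_eventually (hp.mono fun _ h => h.2.2.1) h.y h.vy
  · exact hasDerivWithinAt_Ici_of_eventually (hp.mono fun _ h => h.2.2.2.1) h.y h.vy

lemma GermRight.hasDeriv_vy (h : GermRight μ γ m t) :
    HasDerivWithinAt (fun s => (m s).vy) ((m t).upperAccel μ γ) (Set.Ici t) t := by
  rcases h.phase with ⟨hs, hp⟩ | ⟨hs, hp⟩
  · exact hasDerivWithinAt_Ici_of_eventually (hp.mono fun _ h => h.2.2.2) h.vy
      h.tendsto_upperAccel
  · exact hasDerivWithinAt_Ici_of_eventually (hp.mono fun _ h => h.2.2.2.2) h.vy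
      h.tendsto_upperAccel

lemma GermRight.hasDeriv_vx_of_sticks (h : GermRight μ γ m t) (hs : (m t).Sticks μ γ) :
    HasDerivWithinAt (fun s => (m s).vx) 0 (Set.Ici t) t :=
  hasDerivWithinAt_Ici_of_eventually_eq_const ((h.eventually_contact hs).mono fun _ h => h.2.1)
    hs.2.1

lemma GermRight.hasDeriv_vx (h : GermRight μ γ m t) (hs : ¬ (m t).Sticks μ γ) :
    HasDerivWithinAt (fun s => (m s).vx) ((m t).lowerAccel μ γ) (Set.Ici t) t :=
  hasDerivWithinAt_Ici_of_eventually ((h.eventually_flight hs).mono fun _ h => h.2.2.1) h.vx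
    h.tendsto_lowerAccel

/-- One formula serves both phases: in contact the derivative of `vx` is not `lowerAccel`, but the
factor `vx` vanishes. -/
lemma GermRight.hasDeriv_vx_sq (h : GermRight μ γ m t) :
    HasDerivWithinAt (fun s => (m s).vx ^ 2) (2 * (m t).vx * (m t).lowerAccel μ γ)
      (Set.Ici t) t := by
  by_cases hs : (m t).Sticks μ γ
  · exact ((h.hasDeriv_vx_of_sticks hs).pow 2).congr_deriv (by simp [hs.2.1])
  · exact ((h.hasDeriv_vx hs).pow 2).congr_deriv (by simp)

/-- The rules do not say that the mass leaves the floor upwards. It follows from `x ≥ 0` to the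
right of `t`: the right difference quotients of `x` at a zero are nonnegative. -/
lemma GermRight.vx_nonneg (h : GermRight μ γ m t) (h0 : (m t).x = 0) : 0 ≤ (m t).vx := by
  have h1 := (hasDerivWithinAt_iff_tendsto_slope' (by simp : t ∉ Set.Ioi t)).1
    (h.hasDeriv_x.mono Set.Ioi_subset_Ici_self)
  refine ge_of_tendsto h1 ?_
  have h2 : ∀ᶠ s in 𝓝[>] t, 0 ≤ (m s).x := by
    rcases h.phase with ⟨hs, hp⟩ | ⟨hs, hp⟩
    · exact hp.mono fun _ h => h.1.ge
    · exact hp.mono fun _ h => h.1.le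
  filter_upwards [h2, self_mem_nhdsWithin] with s h3 h4
  have h4 : t < s := h4
  rw [slope_def_field, h0]
  exact div_nonneg (by linarith) (by linarith)

lemma GermLeft.vx_sq (h : GermLeft μ γ m t) (h0 : 0 ≤ (m t).x) :
    Tendsto (fun s => (m s).vx ^ 2) (𝓝[<] t) (𝓝 ((m t).vx ^ 2)) := by
  rcases h0.eq_or_lt with h0 | h0
  · have := (h.impact h0.symm).pow 2
    rwa [neg_sq] at this
  · exact (h.vx h0).pow 2

end RightDerivatives

/-! ### Energy and boundedness -/

/-- The mechanical energy of the ball. -/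
noncomputable def BallState.energy (γ : ℝ) (u : BallState) : ℝ :=
  u.vx ^ 2 / 2 + u.vy ^ 2 / 2 + γ * (u.x + u.y) + (u.y - u.x - 1) ^ 2 / 4

lemma GermRight.hasDeriv_energy {μ γ : ℝ} {m : ℝ → BallState} {t : ℝ} (h : GermRight μ γ m t) :
    HasDerivWithinAt (fun s => (m s).energy γ) (-(μ * ((m t).vy - (m t).vx) ^ 2))
      (Set.Ici t) t := by
  have := (((h.hasDeriv_vx_sq.div_const 2).add ((h.hasDeriv_vy.pow 2).div_const 2)).add
    ((h.hasDeriv_x.add h.hasDeriv_y).const_mul γ)).add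
    ((((h.hasDeriv_y.sub h.hasDeriv_x).sub_const 1).pow 2).div_const 4)
  refine this.congr_deriv ?_
  simp only [BallState.lowerAccel, BallState.upperAccel, Pi.sub_apply]
  push_cast
  ring

lemma GermLeft.energy {μ γ : ℝ} {m : ℝ → BallState} {t : ℝ} (h : GermLeft μ γ m t)
    (h0 : 0 ≤ (m t).x) :
    Tendsto (fun s => (m s).energy γ) (𝓝[<] t) (𝓝 ((m t).energy γ)) :=
  ((((h.vx_sq h0).div_const 2).add ((h.vy.pow 2).div_const 2)).add
    ((h.x.add h.y).const_mul γ)).add ((((h.y.sub h.x).sub_const 1).pow 2).div_const 4)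

section Bounds

variable {μ γ : ℝ} {T : EReal} {u : BallState} {m : ℝ → BallState}

lemma IsMotion.germRight_of_lt (h : IsMotion μ γ T u m) {a b t : ℝ} (ha : 0 ≤ a)
    (hb : b ∈ timeDomain T) (h1 : a ≤ t) (h2 : t ≤ b) : GermRight μ γ m t :=
  h.germRight (mem_timeDomain_of_le hb (ha.trans h1) h2)

lemma IsMotion.germLeft_of_le (h : IsMotion μ γ T u m) {a b t : ℝ} (ha : 0 ≤ a)
    (hb : b ∈ timeDomain T) (h1 : a < t) (h2 : t ≤ b) : GermLeft μ γ m t :=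
  h.germLeft (mem_timeDomain_of_le hb (ha.trans h1.le) h2) (ha.trans_lt h1)

lemma IsMotion.energy_le (hμ : 0 < μ) (h : IsMotion μ γ T u m) {a b : ℝ} (ha : 0 ≤ a)
    (hab : a ≤ b) (hb : b ∈ timeDomain T) : (m b).energy γ ≤ (m a).energy γ := by
  have := le_of_rightDeriv_nonneg (φ := fun t => -(m t).energy γ) hab
    (fun t h1 h2 => ⟨_, ?_, (h.germRight_of_lt ha hb h1 h2.le).hasDeriv_energy.neg⟩)
    (fun t h1 h2 => ((h.germLeft_of_le ha hb h1 h2).energy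
      (h.germRight_of_lt ha hb h1.le h2).nonneg).neg)
  · linarith
  · have := mul_nonneg hμ.le (sq_nonneg ((m t).vy - (m t).vx)); linarith

/-- Completing the square in the spring length writes the energy, up to a constant, as a sum of
terms that are nonnegative for `x ≥ 0` and `γ > 0`. Every a priori bound rests on this. -/
lemma BallState.energy_eq (γ : ℝ) (u : BallState) :
    u.energy γ + γ ^ 2 - γ = u.vx ^ 2 / 2 + u.vy ^ 2 / 2 + 2 * γ * u.x +
      ((u.y - u.x - 1) / 2 + γ) ^ 2 := by
  unfold BallState.energy; ring

/-- Motions are bounded. -/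
lemma IsMotion.exists_bound (hμ : 0 < μ) (hγ : 0 < γ) (h : IsMotion μ γ T u m) :
    ∃ M : ℝ, 0 < M ∧ ∀ t ∈ timeDomain T, |(m t).x| ≤ M ∧ |(m t).vx| ≤ M ∧ |(m t).y| ≤ M ∧
      |(m t).vy| ≤ M := by
  set B := |(m 0).energy γ + γ ^ 2 - γ| with hB
  have hB0 : 0 ≤ B := abs_nonneg _
  refine ⟨2 * (B + 1) + 2 * γ + B / (2 * γ) + 1, by positivity, fun t ht => ?_⟩
  have h1 := h.energy_le hμ le_rfl ht.1 ht
  have h2 := (m t).energy_eq γ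
  have h3 : (m t).vx ^ 2 / 2 + (m t).vy ^ 2 / 2 + 2 * γ * (m t).x +
      (((m t).y - (m t).x - 1) / 2 + γ) ^ 2 ≤ B := by
    rw [← h2]; exact le_trans (by linarith) (le_abs_self _)
  have hx := h.nonneg t ht
  have hx' : 0 ≤ 2 * γ * (m t).x := by positivity
  have s1 := sq_nonneg (m t).vx
  have s2 := sq_nonneg (m t).vy
  have s3 := sq_nonneg (((m t).y - (m t).x - 1) / 2 + γ)
  have hsq : ∀ z : ℝ, z ^ 2 ≤ 2 * B → |z| ≤ B + 1 := by
    intro z hz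
    refine abs_le_of_sq_le_sq (by nlinarith) (by linarith)
  have b1 := hsq (m t).vx (by linarith)
  have b2 := hsq (m t).vy (by linarith)
  have b3 := hsq (((m t).y - (m t).x - 1) / 2 + γ) (by linarith)
  have b4 : (m t).x ≤ B / (2 * γ) := by
    rw [le_div_iff₀ (by positivity)]; linarith
  have b5 : 0 ≤ B / (2 * γ) := by positivity
  rw [abs_le] at b1 b2 b3
  refine ⟨?_, ?_, ?_, ?_⟩ <;> rw [abs_le] <;> constructor <;> linarith [b1.1, b1.2, b2.1, b2.2, b3.1, b3.2]

lemma BallState.abs_lowerAccel_le (hμ : 0 < μ) (hγ : 0 < γ) {u : BallState} {M : ℝ}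
    (hx : |u.x| ≤ M) (hvx : |u.vx| ≤ M) (hy : |u.y| ≤ M) (hvy : |u.vy| ≤ M) :
    |u.lowerAccel μ γ| ≤ γ + 1 / 2 + M + 2 * μ * M := by
  unfold BallState.lowerAccel
  rw [abs_le] at *
  constructor <;> nlinarith

lemma BallState.abs_upperAccel_le (hμ : 0 < μ) (hγ : 0 < γ) {u : BallState} {M : ℝ}
    (hx : |u.x| ≤ M) (hvx : |u.vx| ≤ M) (hy : |u.y| ≤ M) (hvy : |u.vy| ≤ M) :
    |u.upperAccel μ γ| ≤ γ + 1 / 2 + M + 2 * μ * M := by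
  unfold BallState.upperAccel
  rw [abs_le] at *
  constructor <;> nlinarith

/-- While the lower mass is above the floor, the ball is in flight. -/
lemma IsMotion.flightAt_of_pos (h : IsMotion μ γ T u m) {t : ℝ} (ht : t ∈ timeDomain T)
    (h0 : 0 < t) (hx : 0 < (m t).x) : FlightAt μ γ m t := by
  have hr := h.germRight ht
  have hl := h.germLeft ht h0
  have hs : ¬ (m t).Sticks μ γ := fun hs => hx.ne' hs.1
  have hfl : ∀ᶠ s in 𝓝[<] t, FlightAt μ γ m s := by
    rcases hl.phase with hp | hp
    · exfalso
      have h1 : Tendsto (fun s => (m s).x) (𝓝[<] t) (𝓝 0) :=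
        tendsto_const_nhds.congr' (hp.mono fun s hs => hs.1.symm)
      exact hx.ne (tendsto_nhds_unique h1 hl.x)
    · exact hp
  have hlow : Tendsto (fun s => (m s).lowerAccel μ γ) (𝓝[<] t) (𝓝 ((m t).lowerAccel μ γ)) :=
    ((((tendsto_const_nhds).add (hl.y.div_const 2)).add (hl.vy.const_mul μ)).sub
      ((hl.vx hx).const_mul μ)).sub (hl.x.div_const 2)
  have hupp : Tendsto (fun s => (m s).upperAccel μ γ) (𝓝[<] t) (𝓝 ((m t).upperAccel μ γ)) :=
    ((((tendsto_const_nhds).add (hl.x.div_const 2)).add ((hl.vx hx).const_mul μ)).sub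
      (hl.y.div_const 2)).sub (hl.vy.const_mul μ)
  refine ⟨hx, ?_, ?_, ?_, ?_⟩
  · exact (hasDerivWithinAt_Iic_of_eventually (hfl.mono fun _ h => h.2.1) hl.x
      (hl.vx hx)).hasDerivAt_of_Iic_of_Ici hr.hasDeriv_x
  · exact (hasDerivWithinAt_Iic_of_eventually (hfl.mono fun _ h => h.2.2.1) (hl.vx hx)
      hlow).hasDerivAt_of_Iic_of_Ici (hr.hasDeriv_vx hs)
  · exact (hasDerivWithinAt_Iic_of_eventually (hfl.mono fun _ h => h.2.2.2.1) hl.y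
      hl.vy).hasDerivAt_of_Iic_of_Ici hr.hasDeriv_y
  · exact (hasDerivWithinAt_Iic_of_eventually (hfl.mono fun _ h => h.2.2.2.2) hl.vy
      hupp).hasDerivAt_of_Iic_of_Ici hr.hasDeriv_vy

/-- While the lower mass lies at rest on the floor, the ball is in contact. -/
lemma IsMotion.contactAt_of_zero (h : IsMotion μ γ T u m) {t : ℝ} (ht : t ∈ timeDomain T)
    (h0 : 0 < t) (hx : (m t).x = 0) (hvx : (m t).vx = 0)
    (hz : ∀ᶠ s in 𝓝[<] t, (m s).x = 0) : ContactAt μ γ m t := by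
  have hr := h.germRight ht
  have hl := h.germLeft ht h0
  have hfl : ∀ᶠ s in 𝓝[<] t, ContactAt μ γ m s := by
    rcases hl.phase with hp | hp
    · exact hp
    · obtain ⟨s, hs⟩ := (hp.and hz).exists
      exact absurd hs.2 hs.1.1.ne'
  have hlvx : Tendsto (fun s => (m s).vx) (𝓝[<] t) (𝓝 (m t).vx) := by
    have := hl.impact hx
    rwa [hvx, neg_zero, ← hvx] at this
  have hupp : Tendsto (fun s => (m s).upperAccel μ γ) (𝓝[<] t) (𝓝 ((m t).upperAccel μ γ)) :=
    ((((tendsto_const_nhds).add (hl.x.div_const 2)).add (hlvx.const_mul μ)).sub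
      (hl.y.div_const 2)).sub (hl.vy.const_mul μ)
  refine ⟨hx, hvx, ?_, ?_⟩
  · exact (hasDerivWithinAt_Iic_of_eventually (hfl.mono fun _ h => h.2.2.1) hl.y
      hl.vy).hasDerivAt_of_Iic_of_Ici hr.hasDeriv_y
  · exact (hasDerivWithinAt_Iic_of_eventually (hfl.mono fun _ h => h.2.2.2) hl.vy
      hupp).hasDerivAt_of_Iic_of_Ici hr.hasDeriv_vy

end Bounds

/-! ### Convergence to the equilibrium -/

lemma HasDerivWithinAt.const_mul_id (c : ℝ) (t : ℝ) (s : Set ℝ) :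
    HasDerivWithinAt (fun s : ℝ => c * s) c s t := by
  simpa using ((hasDerivWithinAt_id t s).const_mul c)

/-- If a bounded function has a slowly varying derivative, then the derivative tends to zero. -/
lemma tendsto_zero_of_slowly_varying {B h : ℝ → ℝ} {M : ℝ} (hB : ∀ t, 0 ≤ t → |B t| ≤ M)
    (hd : ∀ t, 0 ≤ t → HasDerivWithinAt B (h t) (Set.Ici t) t)
    (hl : ∀ t, 0 < t → ContinuousWithinAt B (Set.Iio t) t)
    (hs : ∀ L > 0, ∀ ε > 0, ∀ᶠ t in atTop, ∀ b, t ≤ b → b ≤ t + L → |h b - h t| ≤ ε) :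
    Tendsto h atTop (𝓝 0) := by
  have hM : 0 ≤ M := (abs_nonneg _).trans (hB 0 le_rfl)
  rw [Metric.tendsto_nhds]
  intro ε hε
  -- If `|h t| ≥ ε` and `h` moves by at most `ε / 2` on the window, `B` changes by at least `ε L / 2
  -- = 2 M + 2`, more than `|B| ≤ M` allows.
  set L := (4 * M + 4) / ε with hL
  have hL0 : 0 < L := by positivity
  filter_upwards [hs L hL0 (ε / 2) (by linarith), eventually_ge_atTop 0] with t h1 h2
  have h3 := abs_sub_le_of_rightDeriv (φ := fun s => B s - h t * s) (φ' := fun s => h s - h t)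
    (K := ε / 2) (by linarith : t ≤ t + L)
    (fun s h3 h4 => ⟨(hd s (h2.trans h3)).sub (HasDerivWithinAt.const_mul_id _ _ _),
      h1 s h3 h4.le⟩)
    (fun s h3 h4 => ContinuousWithinAt.sub (hl s (h2.trans_lt h3)) (by fun_prop))
  have h4 := hB t h2
  have h5 := hB (t + L) (by linarith)
  have h6 : ε * L = 4 * M + 4 := by rw [hL]; field_simp
  rw [Real.dist_eq, sub_zero, abs_lt]
  rw [abs_le] at h3 h4 h5
  constructor
  · by_contra! hcon
    have := mul_le_mul_of_nonneg_right hcon hL0.le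
    linarith [h3.1, h3.2, h4.1, h4.2, h5.1, h5.2]
  · by_contra! hcon
    have := mul_le_mul_of_nonneg_right hcon hL0.le
    linarith [h3.1, h3.2, h4.1, h4.2, h5.1, h5.2]

section Convergence

variable {μ γ : ℝ} {u : BallState} {m : ℝ → BallState}

lemma mem_timeDomain_top {t : ℝ} : t ∈ timeDomain ⊤ ↔ 0 ≤ t := by
  simp [timeDomain, EReal.coe_lt_top]

/-- The change of the spring length is controlled by the loss of energy. -/
lemma IsMotion.abs_spring_sub_le (hμ : 0 < μ) (h : IsMotion μ γ ⊤ u m) {a b η : ℝ} (ha : 0 ≤ a)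
    (hab : a ≤ b) (hη : 0 < η) :
    |((m b).y - (m b).x) - ((m a).y - (m a).x)| ≤
      η * (b - a) + ((m a).energy γ - (m b).energy γ) / (4 * η * μ) := by
  have hd : ∀ t, 0 ≤ t → GermRight μ γ m t := fun t ht => h.germRight (mem_timeDomain_top.2 ht)
  have hl : ∀ t, 0 < t → GermLeft μ γ m t :=
    fun t ht => h.germLeft (mem_timeDomain_top.2 ht.le) ht
  -- The inequality `|v| ≤ η + v² / (4η)` trades the speed of the spring for the dissipation rate `μ
  -- v²`.
  have key : ∀ v : ℝ, |v| ≤ η + μ * v ^ 2 / (4 * η * μ) := by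
    intro v
    have e : μ * v ^ 2 / (4 * η * μ) = v ^ 2 / (4 * η) := by field_simp
    rw [e, ← sub_le_iff_le_add', le_div_iff₀ (by positivity), ← sq_abs v]
    nlinarith [sq_nonneg (|v| - 2 * η)]
  have h1 := le_of_rightDeriv_nonneg
    (φ := fun t => (η * t - (m t).energy γ / (4 * η * μ)) - ((m t).y - (m t).x)) hab
    (fun t h1 h2 => ⟨_, ?_, ((HasDerivWithinAt.const_mul_id η t _).sub
      ((hd t (ha.trans h1)).hasDeriv_energy.div_const _)).sub
      ((hd t (ha.trans h1)).hasDeriv_y.sub (hd t (ha.trans h1)).hasDeriv_x)⟩)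
    (fun t h1 h2 => ContinuousWithinAt.sub (ContinuousWithinAt.sub (by fun_prop)
      (((hl t (ha.trans_lt h1)).energy (hd t (ha.trans h1.le)).nonneg).div_const _))
      ((hl t (ha.trans_lt h1)).y.sub (hl t (ha.trans_lt h1)).x))
  · have h2 := le_of_rightDeriv_nonneg
      (φ := fun t => (η * t - (m t).energy γ / (4 * η * μ)) + ((m t).y - (m t).x)) hab
      (fun t h1 h2 => ⟨_, ?_, ((HasDerivWithinAt.const_mul_id η t _).sub
        ((hd t (ha.trans h1)).hasDeriv_energy.div_const _)).add
        ((hd t (ha.trans h1)).hasDeriv_y.sub (hd t (ha.trans h1)).hasDeriv_x)⟩)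
      (fun t h1 h2 => ContinuousWithinAt.add (ContinuousWithinAt.sub (by fun_prop)
        (((hl t (ha.trans_lt h1)).energy (hd t (ha.trans h1.le)).nonneg).div_const _))
        ((hl t (ha.trans_lt h1)).y.sub (hl t (ha.trans_lt h1)).x))
    · rw [sub_div, abs_le]
      constructor <;> linarith
    · have := key ((m t).vy - (m t).vx)
      rw [neg_div]
      linarith [neg_abs_le ((m t).vy - (m t).vx)]
  · have := key ((m t).vy - (m t).vx)
    rw [neg_div]
    linarith [le_abs_self ((m t).vy - (m t).vx)]

lemma IsMotion.exists_tendsto_energy (hμ : 0 < μ) (hγ : 0 < γ) (h : IsMotion μ γ ⊤ u m) :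
    ∃ e, Tendsto (fun t => (m t).energy γ) atTop (𝓝 e) ∧ ∀ t, 0 ≤ t → e ≤ (m t).energy γ := by
  -- Nothing is known at negative times, hence the truncation `max t 0`.
  have hanti : Antitone fun t => (m (max t 0)).energy γ := fun a b hab =>
    h.energy_le hμ (le_max_right _ _) (max_le_max_right _ hab)
      (mem_timeDomain_top.2 (le_max_right _ _))
  have hbdd : BddBelow (Set.range fun t => (m (max t 0)).energy γ) := by
    refine ⟨γ - γ ^ 2, ?_⟩
    rintro _ ⟨t, rfl⟩
    have h1 := (m (max t 0)).energy_eq γ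
    have h2 := h.nonneg _ (mem_timeDomain_top.2 (le_max_right t 0))
    have h3 : 0 ≤ 2 * γ * (m (max t 0)).x := by positivity
    simp only
    nlinarith [sq_nonneg (m (max t 0)).vx, sq_nonneg (m (max t 0)).vy,
      sq_nonneg (((m (max t 0)).y - (m (max t 0)).x - 1) / 2 + γ)]
  refine ⟨_, (tendsto_atTop_ciInf hanti hbdd).congr' ?_, fun t ht => ?_⟩
  · filter_upwards [eventually_ge_atTop 0] with t ht
    rw [max_eq_left ht]
  · have := ciInf_le hbdd t
    rwa [max_eq_left ht] at this

lemma IsMotion.spring_slowly_varying (hμ : 0 < μ) (hγ : 0 < γ) (h : IsMotion μ γ ⊤ u m) :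
    ∀ L > 0, ∀ ε > 0, ∀ᶠ t in atTop, ∀ b, t ≤ b → b ≤ t + L →
      |((m b).y - (m b).x) - ((m t).y - (m t).x)| ≤ ε := by
  intro L hL ε hε
  obtain ⟨e, he, hle⟩ := h.exists_tendsto_energy hμ hγ
  set η := ε / (2 * L) with hη
  have hη0 : 0 < η := by positivity
  have hpos : 0 < ε / 2 * (4 * η * μ) := by positivity
  filter_upwards [he.eventually (gt_mem_nhds (lt_add_of_pos_right e hpos)),
    eventually_ge_atTop 0] with t h1 h2 b h3 h4
  refine (h.abs_spring_sub_le hμ h2 h3 hη0).trans ?_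
  have h5 : η * (b - t) ≤ ε / 2 := by
    calc η * (b - t) ≤ η * L := by gcongr; linarith
      _ = ε / 2 := by rw [hη]; field_simp
  have h6 : ((m t).energy γ - (m b).energy γ) / (4 * η * μ) ≤ ε / 2 := by
    rw [div_le_iff₀ (by positivity)]
    linarith [hle b (h2.trans h3)]
  linarith

/-- In `vy + μ (y - x)` the damping cancels, so its derivative `-γ - (y - x - 1) / 2` is a function
of the spring length alone and inherits its slow variation. -/
lemma IsMotion.tendsto_spring (hμ : 0 < μ) (hγ : 0 < γ) (h : IsMotion μ γ ⊤ u m) :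
    Tendsto (fun t => (m t).y - (m t).x) atTop (𝓝 (1 - 2 * γ)) := by
  have hd : ∀ t, 0 ≤ t → GermRight μ γ m t := fun t ht => h.germRight (mem_timeDomain_top.2 ht)
  have hl : ∀ t, 0 < t → GermLeft μ γ m t :=
    fun t ht => h.germLeft (mem_timeDomain_top.2 ht.le) ht
  obtain ⟨M, hM, hb⟩ := h.exists_bound hμ hγ
  have key := tendsto_zero_of_slowly_varying
    (B := fun t => (m t).vy + μ * ((m t).y - (m t).x))
    (h := fun t => -γ - ((m t).y - (m t).x - 1) / 2) (M := M + μ * (M + M)) ?_ ?_ ?_ ?_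
  · have := ((key.add_const γ).mul_const (-2)).add_const 1
    refine (this.congr fun t => ?_).trans_eq ?_
    · ring
    · congr 1; ring
  · intro t ht
    obtain ⟨h1, h2, h3, h4⟩ := hb t (mem_timeDomain_top.2 ht)
    rw [abs_le] at *
    constructor <;> nlinarith
  · intro t ht
    refine ((hd t ht).hasDeriv_vy.add
      (((hd t ht).hasDeriv_y.sub (hd t ht).hasDeriv_x).const_mul μ)).congr_deriv ?_
    simp only [BallState.upperAccel]; ring
  · intro t ht
    exact (hl t ht).vy.add (((hl t ht).y.sub (hl t ht).x).const_mul μ)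
  · intro L hL ε hε
    filter_upwards [h.spring_slowly_varying hμ hγ L hL ε hε] with t h1 b h2 h3
    have := h1 b h2 h3
    rw [abs_le] at *
    constructor <;> linarith

/-- On late windows `vy + μ (y - x)` has small derivative and `y - x` varies slowly, so `vy` varies
slowly; it is the derivative of the bounded function `y`. -/
lemma IsMotion.tendsto_vy (hμ : 0 < μ) (hγ : 0 < γ) (h : IsMotion μ γ ⊤ u m) :
    Tendsto (fun t => (m t).vy) atTop (𝓝 0) := by
  have hd : ∀ t, 0 ≤ t → GermRight μ γ m t := fun t ht => h.germRight (mem_timeDomain_top.2 ht)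
  have hl : ∀ t, 0 < t → GermLeft μ γ m t :=
    fun t ht => h.germLeft (mem_timeDomain_top.2 ht.le) ht
  obtain ⟨M, hM, hb⟩ := h.exists_bound hμ hγ
  refine tendsto_zero_of_slowly_varying (B := fun t => (m t).y) (M := M)
    (fun t ht => (hb t (mem_timeDomain_top.2 ht)).2.2.1) (fun t ht => (hd t ht).hasDeriv_y)
    (fun t ht => (hl t ht).y) ?_
  intro L hL ε hε
  have hε' : 0 < ε / (2 * L) := by positivity
  have hsmall := (Metric.tendsto_nhds.1 (h.tendsto_spring hμ hγ) _ hε').exists_forall_of_atTop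
  obtain ⟨t₀, ht₀⟩ := hsmall
  filter_upwards [h.spring_slowly_varying hμ hγ L hL (ε / (2 * μ)) (by positivity),
    eventually_ge_atTop 0, eventually_ge_atTop t₀] with t h1 h2 h3 b h4 h5
  have h6 := abs_sub_le_of_rightDeriv (φ := fun t => (m t).vy + μ * ((m t).y - (m t).x))
    (φ' := fun t => -γ - ((m t).y - (m t).x - 1) / 2) (K := ε / (2 * L)) h4
    (fun s h6 h7 => ⟨((hd s (h2.trans h6)).hasDeriv_vy.add
      (((hd s (h2.trans h6)).hasDeriv_y.sub (hd s (h2.trans h6)).hasDeriv_x).const_mul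
        μ)).congr_deriv (by simp only [BallState.upperAccel]; ring), ?_⟩)
    (fun s h6 h7 => (hl s (h2.trans_lt h6)).vy.add
      (((hl s (h2.trans_lt h6)).y.sub (hl s (h2.trans_lt h6)).x).const_mul μ))
  · have h7 : ε / (2 * L) * (b - t) ≤ ε / 2 := by
      calc ε / (2 * L) * (b - t) ≤ ε / (2 * L) * L := by gcongr; linarith
        _ = ε / 2 := by field_simp
    have h8 := mul_le_mul_of_nonneg_left (h1 b h4 h5) hμ.le
    have h9 : μ * (ε / (2 * μ)) = ε / 2 := by field_simp
    rw [h9] at h8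
    have h8 : |μ * (((m b).y - (m b).x) - ((m t).y - (m t).x))| ≤ ε / 2 := by
      rwa [abs_mul, abs_of_pos hμ]
    rw [abs_le] at *
    constructor <;> linarith [h6.1, h6.2, h8.1, h8.2]
  · have := ht₀ s (h3.trans h6)
    rw [Real.dist_eq, abs_lt] at this
    rw [abs_le]
    constructor <;> linarith [this.1, this.2]

lemma IsMotion.tendsto_x (hμ : 0 < μ) (hγ : 0 < γ) (h : IsMotion μ γ ⊤ u m) :
    Tendsto (fun t => (m t).x) atTop (𝓝 0) := by
  have hd : ∀ t, 0 ≤ t → GermRight μ γ m t := fun t ht => h.germRight (mem_timeDomain_top.2 ht)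
  have hl : ∀ t, 0 < t → GermLeft μ γ m t :=
    fun t ht => h.germLeft (mem_timeDomain_top.2 ht.le) ht
  obtain ⟨M, hM, hb⟩ := h.exists_bound hμ hγ
  rw [Metric.tendsto_nhds]
  intro ε hε
  -- In flight `vx + vy` decreases at rate `2γ`. Over a window of this length it would lose `4 M +
  -- 1`, while it is bounded by `2 M` in absolute value.
  set L := (4 * M + 1) / (2 * γ) with hL
  have hL0 : 0 < L := by positivity
  have hε' : 0 < ε / (4 * L) := by positivity
  obtain ⟨t₀, ht₀⟩ := (Metric.tendsto_nhds.1 (h.tendsto_vy hμ hγ) _ hε').exists_forall_of_atTop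
  filter_upwards [h.spring_slowly_varying hμ hγ L hL0 (ε / 4) (by positivity),
    eventually_gt_atTop 0, eventually_ge_atTop t₀] with t h1 h2 h3
  rw [Real.dist_eq, sub_zero, abs_of_nonneg (hd t h2.le).nonneg]
  by_contra! hcon
  -- From `x ≥ ε` at time `t`: over the window both `y` and `y - x` change by at most `ε / 4`, so
  -- `x` stays at least `ε / 2`.
  have hpos : ∀ b, t ≤ b → b ≤ t + L → 0 < (m b).x := by
    intro b h4 h5
    have h6 := abs_sub_le_of_rightDeriv (φ := fun t => (m t).y) (φ' := fun t => (m t).vy)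
      (K := ε / (4 * L)) h4 (fun s h6 h7 => ⟨(hd s (h2.le.trans h6)).hasDeriv_y, ?_⟩)
      (fun s h6 h7 => (hl s (h2.trans h6)).y)
    · have h7 : ε / (4 * L) * (b - t) ≤ ε / 4 := by
        calc ε / (4 * L) * (b - t) ≤ ε / (4 * L) * L := by gcongr; linarith
          _ = ε / 4 := by field_simp
      have h8 := h1 b h4 h5
      rw [abs_le] at *
      linarith [h6.1, h6.2, h8.1, h8.2]
    · have := ht₀ s (h3.trans h6)
      rw [Real.dist_eq, sub_zero] at this
      exact this.le
  have h6 := le_of_rightDeriv_nonneg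
    (φ := fun s => (-(2 * γ)) * s - ((m s).vx + (m s).vy)) (by linarith : t ≤ t + L)
    (fun s h4 h5 => ⟨0, le_rfl, ?_⟩) (fun s h4 h5 => ?_)
  · have e : 2 * γ * L = 4 * M + 1 := by rw [hL]; field_simp
    have b1 := hb t (mem_timeDomain_top.2 h2.le)
    have b2 := hb (t + L) (mem_timeDomain_top.2 (by linarith))
    have := abs_le.1 b1.2.1
    have := abs_le.1 b1.2.2.2
    have := abs_le.1 b2.2.1
    have := abs_le.1 b2.2.2.2
    linarith
  · have hg := hd s (h2.le.trans h4)
    have hs : ¬ (m s).Sticks μ γ := fun hs => (hpos s h4 h5.le).ne' hs.1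
    refine ((HasDerivWithinAt.const_mul_id _ s _).sub
      ((hg.hasDeriv_vx hs).add hg.hasDeriv_vy)).congr_deriv ?_
    simp only [BallState.upperAccel, BallState.lowerAccel]; ring
  · have hg := hl s (h2.trans h4)
    exact ContinuousWithinAt.sub (by fun_prop) ((hg.vx (hpos s h4.le h5)).add hg.vy)

lemma IsMotion.tendsto_y (hμ : 0 < μ) (hγ : 0 < γ) (h : IsMotion μ γ ⊤ u m) :
    Tendsto (fun t => (m t).y) atTop (𝓝 (1 - 2 * γ)) := by
  have := (h.tendsto_spring hμ hγ).add (h.tendsto_x hμ hγ)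
  simpa using this

lemma IsMotion.tendsto_vx (hμ : 0 < μ) (hγ : 0 < γ) (h : IsMotion μ γ ⊤ u m) :
    Tendsto (fun t => (m t).vx) atTop (𝓝 0) := by
  have hd : ∀ t, 0 ≤ t → GermRight μ γ m t := fun t ht => h.germRight (mem_timeDomain_top.2 ht)
  have hl : ∀ t, 0 < t → GermLeft μ γ m t :=
    fun t ht => h.germLeft (mem_timeDomain_top.2 ht.le) ht
  obtain ⟨e, he, hle⟩ := h.exists_tendsto_energy hμ hγ
  have hx := h.tendsto_x hμ hγ
  have hy := h.tendsto_y hμ hγ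
  have hvy := h.tendsto_vy hμ hγ
  obtain ⟨q, hq⟩ : ∃ q, Tendsto (fun t => (m t).vx ^ 2) atTop (𝓝 q) := by
    refine ⟨_, ((((he.sub ((hvy.pow 2).div_const 2)).sub ((hx.add hy).const_mul γ)).sub
      ((((hy.sub hx).sub_const 1).pow 2).div_const 4)).mul_const 2).congr fun t => ?_⟩
    unfold BallState.energy; ring
  have hq0 : 0 ≤ q := ge_of_tendsto' hq fun t => sq_nonneg _
  rcases hq0.eq_or_lt with h0 | h0
  · rw [← h0] at hq
    have := hq.sqrt
    simp only [Real.sqrt_sq_eq_abs, Real.sqrt_zero] at this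
    exact (tendsto_zero_iff_abs_tendsto_zero _).2 this
  · exfalso
    -- This uses `(vy - vx)² ≥ vx² / 2 - vy²`, with `vx² > q / 2` and `vy² < q / 16`.
    have hsmall : ∀ᶠ t in atTop, q / 8 < ((m t).vy - (m t).vx) ^ 2 := by
      filter_upwards [hq.eventually (lt_mem_nhds (by linarith : q / 2 < q)),
        (hvy.pow 2).eventually (gt_mem_nhds (by simpa using by linarith : 0 ^ 2 < q / 16))]
        with t h1 h2
      nlinarith [sq_nonneg (2 * (m t).vy - (m t).vx)]
    obtain ⟨t₀, ht₀⟩ := hsmall.exists_forall_of_atTop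
    set a := max t₀ 0
    have ha : 0 ≤ a := le_max_right _ _
    set c := μ * (q / 8)
    have hc : 0 < c := by positivity
    -- Losing energy at rate at least `c` from `a` on, the motion would be below the limit energy
    -- `e` at this time.
    set b := a + ((m a).energy γ - e + 1) / c
    have hab : a ≤ b := by
      have := hle a ha
      have : 0 ≤ ((m a).energy γ - e + 1) / c := div_nonneg (by linarith) hc.le
      linarith
    have h1 := le_of_rightDeriv_nonneg (φ := fun t => (-c) * t - (m t).energy γ) hab
      (fun t h1 h2 => ⟨_, ?_, (HasDerivWithinAt.const_mul_id _ _ _).sub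
        (hd t (ha.trans h1)).hasDeriv_energy⟩)
      (fun t h1 h2 => ContinuousWithinAt.sub (by fun_prop)
        ((hl t (ha.trans_lt h1)).energy (hd t (ha.trans h1.le)).nonneg))
    · have h2 : c * b = c * a + ((m a).energy γ - e + 1) := by
        simp only [b]; field_simp
      have h3 := hle b (ha.trans hab)
      linarith
    · have : c ≤ _ := mul_le_mul_of_nonneg_left (ht₀ t ((le_max_left _ _).trans h1)).le hμ.le
      linarith

end Convergence

/-! ### The reduced force and accumulation of floor contacts -/

/-- The contact force, corrected by a multiple of `x` so that its derivative is continuous across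
impacts. -/
noncomputable def BallState.reducedForce (μ γ : ℝ) (u : BallState) : ℝ :=
  u.contactForce μ γ - μ ^ 2 * u.x

/-- The time derivative of the reduced force. -/
noncomputable def BallState.reducedForceRate (μ γ : ℝ) (u : BallState) : ℝ :=
  u.vy / 2 + μ * (1 / 2 - γ + u.x / 2 - u.y / 2 - μ * u.vy)

/-- In flight the lower mass is thus a damped linear oscillator driven by the reduced force. Its
stiffness `1/2 - μ²` may have either sign. -/
lemma BallState.lowerAccel_eq_reducedForce (μ γ : ℝ) (u : BallState) :
    u.lowerAccel μ γ = u.reducedForce μ γ - μ * u.vx - (1 / 2 - μ ^ 2) * u.x := by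
  unfold BallState.lowerAccel BallState.reducedForce BallState.contactForce; ring

section ReducedForce

variable {μ γ : ℝ} {m : ℝ → BallState} {t : ℝ}

lemma GermRight.hasDeriv_reducedForce (h : GermRight μ γ m t) :
    HasDerivWithinAt (fun s => (m s).reducedForce μ γ) ((m t).reducedForceRate μ γ)
      (Set.Ici t) t := by
  refine (((((h.hasDeriv_y.div_const 2).add (h.hasDeriv_vy.const_mul μ)).sub_const γ).sub_const
    (1 / 2)).sub (h.hasDeriv_x.const_mul (μ ^ 2))).congr_deriv ?_
  simp only [BallState.reducedForceRate, BallState.upperAccel]; ring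

lemma GermRight.hasDeriv_reducedForceRate (h : GermRight μ γ m t) :
    HasDerivWithinAt (fun s => (m s).reducedForceRate μ γ)
      ((m t).upperAccel μ γ / 2 + μ * ((m t).vx / 2 - (m t).vy / 2 - μ * (m t).upperAccel μ γ))
      (Set.Ici t) t :=
  (h.hasDeriv_vy.div_const 2).add (((((h.hasDeriv_x.div_const 2).const_add _).sub
    (h.hasDeriv_y.div_const 2)).sub (h.hasDeriv_vy.const_mul μ)).const_mul μ)

lemma tendsto_reducedForce {F : Filter ℝ} {X Y V : ℝ}
    (hx : Tendsto (fun s => (m s).x) F (𝓝 X)) (hy : Tendsto (fun s => (m s).y) F (𝓝 Y))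
    (hvy : Tendsto (fun s => (m s).vy) F (𝓝 V)) :
    Tendsto (fun s => (m s).reducedForce μ γ) F
      (𝓝 (Y / 2 + μ * V - γ - 1 / 2 - μ ^ 2 * X)) :=
  ((((hy.div_const 2).add (hvy.const_mul μ)).sub_const γ).sub_const
    (1 / 2)).sub (hx.const_mul (μ ^ 2))

lemma tendsto_reducedForceRate {F : Filter ℝ} {X Y V : ℝ}
    (hx : Tendsto (fun s => (m s).x) F (𝓝 X)) (hy : Tendsto (fun s => (m s).y) F (𝓝 Y))
    (hvy : Tendsto (fun s => (m s).vy) F (𝓝 V)) :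
    Tendsto (fun s => (m s).reducedForceRate μ γ) F
      (𝓝 (V / 2 + μ * (1 / 2 - γ + X / 2 - Y / 2 - μ * V))) :=
  (hvy.div_const 2).add ((((hx.div_const 2).const_add _).sub
    (hy.div_const 2)).sub (hvy.const_mul μ) |>.const_mul μ)

lemma GermLeft.reducedForce (h : GermLeft μ γ m t) :
    Tendsto (fun s => (m s).reducedForce μ γ) (𝓝[<] t) (𝓝 ((m t).reducedForce μ γ)) :=
  tendsto_reducedForce h.x h.y h.vy

lemma GermLeft.reducedForceRate (h : GermLeft μ γ m t) :
    Tendsto (fun s => (m s).reducedForceRate μ γ) (𝓝[<] t)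
      (𝓝 ((m t).reducedForceRate μ γ)) :=
  tendsto_reducedForceRate h.x h.y h.vy

end ReducedForce

/-- A function with negative right derivative that tends to zero at the right end of an interval
is positive on the interval. -/
lemma pos_of_rightDeriv_neg {φ φ' : ℝ → ℝ} {a T : ℝ}
    (hd : ∀ t ∈ Set.Ioo a T, HasDerivWithinAt φ (φ' t) (Set.Ici t) t ∧ φ' t < 0)
    (hl : ∀ t ∈ Set.Ioo a T, ContinuousWithinAt φ (Set.Iio t) t)
    (h0 : Tendsto φ (𝓝[<] T) (𝓝 0)) : ∀ t ∈ Set.Ioo a T, 0 < φ t := by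
  have hanti : ∀ s t, a < s → s ≤ t → t < T → φ t ≤ φ s := by
    intro s t h1 h2 h3
    have := le_of_rightDeriv_nonneg (φ := fun t => -φ t) h2
      (fun r h4 h5 => ⟨-φ' r, by
        linarith [(hd r ⟨h1.trans_le h4, h5.trans h3⟩).2],
        (hd r ⟨h1.trans_le h4, h5.trans h3⟩).1.neg⟩)
      (fun r h4 h5 => (hl r ⟨h1.trans h4, h5.trans_lt h3⟩).neg)
    linarith
  have hnn : ∀ t ∈ Set.Ioo a T, 0 ≤ φ t := by
    intro t ht
    refine le_of_tendsto h0 ?_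
    filter_upwards [Ioo_mem_nhdsLT ht.2] with s hs using hanti t s ht.1 hs.1.le hs.2
  intro t ht
  refine (hnn t ht).lt_of_ne fun hcon => ?_
  have h1 := (hasDerivWithinAt_iff_tendsto_slope' (by simp : t ∉ Set.Ioi t)).1
    ((hd t ht).1.mono Set.Ioi_subset_Ici_self)
  obtain ⟨s, h2, h3⟩ := ((h1.eventually (gt_mem_nhds (hd t ht).2)).and
    (Ioo_mem_nhdsGT ht.2)).exists
  have h3 : s ∈ Set.Ioo t T := h3
  rw [slope_def_field, div_lt_iff₀ (by linarith [h3.1])] at h2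
  linarith [hnn s ⟨ht.1.trans h3.1, h3.2⟩]

section Accumulation

variable {μ γ T : ℝ} {u : BallState} {m : ℝ → BallState}

lemma IsMotion.germRight_coe (h : IsMotion μ γ T u m) {t : ℝ} (h0 : 0 ≤ t) (h1 : t < T) :
    GermRight μ γ m t := h.germRight (mem_timeDomain_coe.2 ⟨h0, h1⟩)

lemma IsMotion.germLeft_coe (h : IsMotion μ γ T u m) {t : ℝ} (h0 : 0 < t) (h1 : t < T) :
    GermLeft μ γ m t := h.germLeft (mem_timeDomain_coe.2 ⟨h0.le, h1⟩) h0

/-- Only a lower bound survives impacts: there `vx` jumps upwards, from `-vx` to `vx ≥ 0`. -/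
lemma IsMotion.vx_sub_le (h : IsMotion μ γ T u m) {a b K : ℝ} (ha : 0 ≤ a) (hab : a ≤ b)
    (hb : b < T) (hK : ∀ t, a ≤ t → t < b → |(m t).lowerAccel μ γ| ≤ K) :
    (m a).vx - K * (b - a) ≤ (m b).vx := by
  rcases hab.eq_or_lt with rfl | hlt
  · simp
  have hK0 : 0 ≤ K := (abs_nonneg _).trans (hK a le_rfl hlt)
  have := le_of_rightDeriv_nonneg_of_jumps (φ := fun t => (m t).vx + K * t) hab
    (fun t h1 h2 => ?_) (fun t h1 h2 => ?_)
  · linarith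
  · have hg := h.germRight_coe (ha.trans h1) (h2.trans hb)
    by_cases hs : (m t).Sticks μ γ
    · exact ⟨0 + K, by linarith,
        (hg.hasDeriv_vx_of_sticks hs).add (HasDerivWithinAt.const_mul_id K t _)⟩
    · exact ⟨_, by linarith [neg_abs_le ((m t).lowerAccel μ γ), hK t h1 h2],
        (hg.hasDeriv_vx hs).add (HasDerivWithinAt.const_mul_id K t _)⟩
  · have hg := h.germLeft_coe (ha.trans_lt h1) (h2.trans_lt hb)
    have hr := h.germRight_coe (ha.trans h1.le) (h2.trans_lt hb)
    have hid : Tendsto (fun t => K * t) (𝓝[<] t) (𝓝 (K * t)) :=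
      (by fun_prop : Continuous fun t : ℝ => K * t).continuousWithinAt
    rcases hr.nonneg.eq_or_lt with h0 | h0
    · exact ⟨-(m t).vx + K * t, by linarith [hr.vx_nonneg h0.symm], (hg.impact h0.symm).add hid⟩
    · exact ⟨_, le_rfl, (hg.vx h0).add hid⟩

lemma IsMotion.x_add_le (h : IsMotion μ γ T u m) {a b δ : ℝ} (ha : 0 ≤ a) (hab : a ≤ b)
    (hb : b < T) (hδ : ∀ t, a ≤ t → t < b → δ ≤ (m t).vx) :
    (m a).x + δ * (b - a) ≤ (m b).x := by
  have := le_of_rightDeriv_nonneg (φ := fun t => (m t).x - δ * t) hab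
    (fun t h1 h2 => ⟨_, sub_nonneg.2 (hδ t h1 h2),
      (h.germRight_coe (ha.trans h1) (h2.trans hb)).hasDeriv_x.sub
        (HasDerivWithinAt.const_mul_id δ t _)⟩)
    (fun t h1 h2 => ContinuousWithinAt.sub
      (h.germLeft_coe (ha.trans_lt h1) (h2.trans_lt hb)).x (by fun_prop))
  linarith

lemma exists_mem_Ioo_of_frequently {p : ℝ → Prop} {a T : ℝ} (h : ∃ᶠ t in 𝓝[<] T, p t)
    (ha : a < T) : ∃ t, a < t ∧ t < T ∧ p t := by
  obtain ⟨t, h1, h2⟩ := (h.and_eventually (Ioo_mem_nhdsLT ha)).exists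
  exact ⟨t, h2.1, h2.2, h1⟩

/-- The states of a motion, except possibly for the velocity of the lower mass, have limits at the
end of a bounded time interval. -/
lemma IsMotion.exists_tendsto_end (hμ : 0 < μ) (hγ : 0 < γ) (hT : 0 < T)
    (h : IsMotion μ γ T u m) : ∃ X Y V : ℝ, Tendsto (fun t => (m t).x) (𝓝[<] T) (𝓝 X) ∧
      Tendsto (fun t => (m t).y) (𝓝[<] T) (𝓝 Y) ∧
      Tendsto (fun t => (m t).vy) (𝓝[<] T) (𝓝 V) := by
  obtain ⟨M, hM, hb⟩ := h.exists_bound hμ hγ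
  have hb' : ∀ t, 0 ≤ t → t < T → _ := fun t h1 h2 => hb t (mem_timeDomain_coe.2 ⟨h1, h2⟩)
  have key : ∀ (φ φ' : ℝ → ℝ) (K : ℝ), 0 ≤ K → (∀ t, 0 ≤ t → t < T →
      HasDerivWithinAt φ (φ' t) (Set.Ici t) t ∧ |φ' t| ≤ K) →
      (∀ t, 0 < t → t < T → ContinuousWithinAt φ (Set.Iio t) t) →
      ∃ l, Tendsto φ (𝓝[<] T) (𝓝 l) := by
    intro φ φ' K hK h1 h2
    exact exists_tendsto_left_of_lipschitz hK (fun s t h3 h4 h5 =>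
      abs_sub_le_of_rightDeriv h4 (fun r h6 h7 => h1 r (h3.trans h6) (h7.trans h5))
        (fun r h6 h7 => h2 r (h3.trans_lt h6) (h7.trans_lt h5))) hT
  obtain ⟨X, hX⟩ := key _ _ M hM.le
    (fun t h1 h2 => ⟨(h.germRight_coe h1 h2).hasDeriv_x, (hb' t h1 h2).2.1⟩)
    (fun t h1 h2 => (h.germLeft_coe h1 h2).x)
  obtain ⟨Y, hY⟩ := key _ _ M hM.le
    (fun t h1 h2 => ⟨(h.germRight_coe h1 h2).hasDeriv_y, (hb' t h1 h2).2.2.2⟩)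
    (fun t h1 h2 => (h.germLeft_coe h1 h2).y)
  obtain ⟨V, hV⟩ := key _ _ (γ + 1 / 2 + M + 2 * μ * M) (by positivity)
    (fun t h1 h2 => ⟨(h.germRight_coe h1 h2).hasDeriv_vy,
      BallState.abs_upperAccel_le hμ hγ (hb' t h1 h2).1 (hb' t h1 h2).2.1 (hb' t h1 h2).2.2.1
        (hb' t h1 h2).2.2.2⟩)
    (fun t h1 h2 => (h.germLeft_coe h1 h2).vy)
  exact ⟨X, Y, V, hX, hY, hV⟩

/-- If floor contacts occur up to the end of the time interval, the velocity of the lower mass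
tends to zero there. -/
lemma IsMotion.tendsto_vx_end (hμ : 0 < μ) (hγ : 0 < γ) (hT : 0 < T)
    (h : IsMotion μ γ T u m) (hz : ∃ᶠ t in 𝓝[<] T, (m t).x = 0) :
    Tendsto (fun t => (m t).vx) (𝓝[<] T) (𝓝 0) := by
  obtain ⟨M, hM, hb⟩ := h.exists_bound hμ hγ
  set K := γ + 1 / 2 + M + 2 * μ * M with hK
  have hK0 : 0 < K := by positivity
  have hlow : ∀ t, 0 ≤ t → t < T → |(m t).lowerAccel μ γ| ≤ K := by
    intro t h1 h2
    obtain ⟨b1, b2, b3, b4⟩ := hb t (mem_timeDomain_coe.2 ⟨h1, h2⟩)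
    exact BallState.abs_lowerAccel_le hμ hγ b1 b2 b3 b4
  have hup : ∀ t, 0 ≤ t → t < T → (m t).vx ≤ K * (T - t) := by
    intro t h1 h2
    -- A velocity above `K (T - t)` cannot be used up by an acceleration bounded by `K` before `T`,
    -- so `x` would increase and no contact could follow.
    by_contra! hcon
    obtain ⟨s, h3, h4, h5⟩ := exists_mem_Ioo_of_frequently hz h2
    have := h.x_add_le (δ := (m t).vx - K * (T - t)) h1 h3.le h4 (fun r h6 h7 => by
      have := h.vx_sub_le h1 h6 (h7.trans h4) (fun q h8 h9 => hlow q (h1.trans h8)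
        (h9.trans (h7.trans h4)))
      have : K * (r - t) ≤ K * (T - t) := by gcongr; linarith
      linarith)
    have h8 := (h.germRight_coe h1 h2).nonneg
    have : 0 < ((m t).vx - K * (T - t)) * (s - t) := mul_pos (by linarith) (by linarith)
    linarith
  rw [Metric.tendsto_nhds]
  intro ε hε
  -- Starting at a contact within `ε / K` of `T`, where `vx ≥ 0`, the velocity cannot drop by `ε`
  -- before `T`.
  have hlt : max 0 (T - ε / K) < T := max_lt hT (by linarith [div_pos hε hK0])
  obtain ⟨a, h1, h2, h3⟩ := exists_mem_Ioo_of_frequently hz hlt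
  have ha0 : 0 ≤ a := (le_max_left _ _).trans h1.le
  have ha1 : K * (T - a) < ε := by
    have : T - a < ε / K := by linarith [(le_max_right 0 (T - ε / K)).trans_lt h1]
    rwa [lt_div_iff₀ hK0, mul_comm] at this
  filter_upwards [Ioo_mem_nhdsLT h2] with t ht
  rw [Real.dist_eq, sub_zero, abs_lt]
  constructor
  · have h4 := h.vx_sub_le ha0 ht.1.le ht.2 (fun q h8 h9 => hlow q (ha0.trans h8) (h9.trans ht.2))
    have h5 := (h.germRight_coe ha0 h2).vx_nonneg h3
    have : K * (t - a) ≤ K * (T - a) := by gcongr; exact ht.2.le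
    linarith
  · have h4 := hup t (ha0.trans ht.1.le) ht.2
    have : K * (T - t) ≤ K * (T - a) := by gcongr; exact ht.1.le
    linarith

/-- Near an accumulation point of floor contacts, the reduced force has a definite sign. -/
lemma IsMotion.reducedForce_sign (hμ : 0 < μ) (hγ : 0 < γ) (hT : 0 < T)
    (h : IsMotion μ γ T u m) (hz : ∃ᶠ t in 𝓝[<] T, (m t).x = 0) :
    (∀ᶠ t in 𝓝[<] T, 0 < (m t).reducedForce μ γ) ∨
    ∃ K, 0 ≤ K ∧ ∀ᶠ t in 𝓝[<] T, (m t).reducedForce μ γ < 0 ∧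
      -(m t).reducedForceRate μ γ ≤ K * -(m t).reducedForce μ γ := by
  obtain ⟨X, Y, V, hX, hY, hV⟩ := h.exists_tendsto_end hμ hγ hT
  have hvx := h.tendsto_vx_end hμ hγ hT hz
  have hX0 : X = 0 := by
    by_contra hne
    exact hz (hX.eventually_ne hne)
  rw [hX0] at hX
  have hf := tendsto_reducedForce (μ := μ) (γ := γ) hX hY hV
  have hG := tendsto_reducedForceRate (μ := μ) (γ := γ) hX hY hV
  set f₀ := Y / 2 + μ * V - γ - 1 / 2 - μ ^ 2 * 0 with hf₀
  set G₀ := V / 2 + μ * (1 / 2 - γ + 0 / 2 - Y / 2 - μ * V) with hG₀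
  have hev : ∀ {p : ℝ → Prop}, (∀ᶠ t in 𝓝[<] T, p t) →
      ∃ a, 0 ≤ a ∧ a < T ∧ ∀ t ∈ Set.Ioo a T, p t := by
    intro p hp
    obtain ⟨a, ha, ha'⟩ := mem_nhdsLT_iff_exists_Ioo_subset.1 hp
    exact ⟨max a 0, le_max_right _ _, max_lt ha hT,
      fun t ht => ha' ⟨(le_max_left _ _).trans_lt ht.1, ht.2⟩⟩
  have hneg : f₀ = 0 → (∀ᶠ t in 𝓝[<] T, 0 < (m t).reducedForceRate μ γ) →
      ∀ᶠ t in 𝓝[<] T, (m t).reducedForce μ γ < 0 := by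
    intro h0 hp
    obtain ⟨a, ha0, haT, ha⟩ := hev hp
    have := pos_of_rightDeriv_neg (φ := fun t => -(m t).reducedForce μ γ)
      (φ' := fun t => -(m t).reducedForceRate μ γ) (a := a) (T := T)
      (fun t ht => ⟨(h.germRight_coe (ha0.trans ht.1.le) ht.2).hasDeriv_reducedForce.neg,
        neg_lt_zero.2 (ha t ht)⟩)
      (fun t ht => (h.germLeft_coe (ha0.trans_lt ht.1) ht.2).reducedForce.neg)
      (by rw [h0] at hf; simpa using hf.neg)
    filter_upwards [Ioo_mem_nhdsLT haT] with t ht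
    linarith [this t ht]
  rcases lt_trichotomy f₀ 0 with hlt | h0 | hgt
  · right
    -- Near `T` the rate exceeds `-(|G₀| + 1)` and the negated force exceeds `-f₀ / 2`; the constant
    -- is their quotient.
    refine ⟨(|G₀| + 1) / (-f₀ / 2), div_nonneg (by positivity) (by linarith), ?_⟩
    filter_upwards [hf.eventually (gt_mem_nhds (by linarith : f₀ < f₀ / 2)),
      hG.eventually (lt_mem_nhds (by linarith [neg_abs_le G₀] : -(|G₀| + 1) < G₀))] with t h1 h2
    refine ⟨by linarith, ?_⟩
    have h3 : (|G₀| + 1) / (-f₀ / 2) * (-f₀ / 2) = |G₀| + 1 :=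
      div_mul_cancel₀ _ (by linarith)
    have h4 : (|G₀| + 1) / (-f₀ / 2) * (-f₀ / 2) ≤
        (|G₀| + 1) / (-f₀ / 2) * -(m t).reducedForce μ γ :=
      mul_le_mul_of_nonneg_left (by linarith) (div_nonneg (by positivity) (by linarith))
    linarith
  · rcases lt_trichotomy G₀ 0 with hlt | hG0 | hgt
    · left
      obtain ⟨a, ha0, haT, ha⟩ := hev (hG.eventually (gt_mem_nhds hlt))
      have := pos_of_rightDeriv_neg (φ := fun t => (m t).reducedForce μ γ)
        (φ' := fun t => (m t).reducedForceRate μ γ) (a := a) (T := T)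
        (fun t ht => ⟨(h.germRight_coe (ha0.trans ht.1.le) ht.2).hasDeriv_reducedForce, ha t ht⟩)
        (fun t ht => (h.germLeft_coe (ha0.trans_lt ht.1) ht.2).reducedForce)
        (by rwa [h0] at hf)
      filter_upwards [Ioo_mem_nhdsLT haT] with t ht using this t ht
    · right
      -- When `f₀ = 0` and `G₀ = 0`, the upper acceleration tends to `-2γ` and the second derivative
      -- of the reduced force to `-γ < 0`. So the rate decreases to zero, hence is positive, and the
      -- force increases to zero, hence is negative.
      have hlim : Tendsto (fun t => (m t).upperAccel μ γ / 2 + μ * ((m t).vx / 2 - (m t).vy / 2 -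
          μ * (m t).upperAccel μ γ)) (𝓝[<] T) (𝓝 (-γ)) := by
        have hU : Tendsto (fun t => (m t).upperAccel μ γ) (𝓝[<] T)
            (𝓝 (-γ + 1 / 2 + 0 / 2 + μ * 0 - Y / 2 - μ * V)) :=
          ((((tendsto_const_nhds).add (hX.div_const 2)).add (hvx.const_mul μ)).sub
            (hY.div_const 2)).sub (hV.const_mul μ)
        refine ((hU.div_const 2).add ((((hvx.div_const 2).sub (hV.div_const 2)).sub
          (hU.const_mul μ)).const_mul μ)).trans_eq ?_
        congr 1
        rw [hf₀] at h0
        rw [hG₀] at hG0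
        linear_combination (-1 / 2 : ℝ) * h0 - μ * hG0
      have hGpos : ∀ᶠ t in 𝓝[<] T, 0 < (m t).reducedForceRate μ γ := by
        obtain ⟨a, ha0, haT, ha⟩ := hev (hlim.eventually (gt_mem_nhds (neg_lt_zero.2 hγ)))
        have := pos_of_rightDeriv_neg (φ := fun t => (m t).reducedForceRate μ γ)
          (a := a) (T := T)
          (fun t ht => ⟨(h.germRight_coe (ha0.trans ht.1.le) ht.2).hasDeriv_reducedForceRate,
            ha t ht⟩)
          (fun t ht => (h.germLeft_coe (ha0.trans_lt ht.1) ht.2).reducedForceRate)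
          (by rwa [hG0] at hG)
        filter_upwards [Ioo_mem_nhdsLT haT] with t ht using this t ht
      refine ⟨0, le_rfl, ?_⟩
      filter_upwards [hGpos, hneg h0 hGpos] with t h1 h2
      exact ⟨h2, by linarith⟩
    · right
      have hGpos := hG.eventually (lt_mem_nhds hgt)
      refine ⟨0, le_rfl, ?_⟩
      filter_upwards [hGpos, hneg h0 hGpos] with t h1 h2
      exact ⟨h2, by linarith⟩
  · exact Or.inl (hf.eventually (lt_mem_nhds hgt))

/-- Floor contacts do not accumulate where the reduced force is positive. -/
lemma IsMotion.not_frequently_zero_of_reducedForce_pos (hμ : 0 < μ) (hT : 0 < T)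
    (h : IsMotion μ γ T u m) (hp : ∀ᶠ t in 𝓝[<] T, 0 < (m t).reducedForce μ γ) :
    ¬ ∃ᶠ t in 𝓝[<] T, (m t).x = 0 := by
  intro hz
  set κ := 1 / 2 - μ ^ 2 with hκ
  set N := 2 * |κ| / μ with hN
  have hN0 : 0 ≤ N := by positivity
  have hNμ : μ * N = 2 * |κ| := by rw [hN]; field_simp
  obtain ⟨a, ha, ha'⟩ := mem_nhdsLT_iff_exists_Ioo_subset.1 hp
  have ha : a < T := ha
  -- The distance `1 / (N + 1)` to `T` keeps the weight `φ` below between 1 and 2.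
  have hlt : max (max a 0) (T - 1 / (N + 1)) < T :=
    max_lt (max_lt ha hT) (by linarith [show 0 < 1 / (N + 1) by positivity])
  obtain ⟨b, hb1, hbT, hbx⟩ := exists_mem_Ioo_of_frequently hz hlt
  have hab : a < b := (le_max_left _ _).trans_lt ((le_max_left _ _).trans_lt hb1)
  have hb0 : 0 ≤ b := (le_max_right a 0).trans ((le_max_left _ _).trans hb1.le)
  have hbN : N * (T - b) ≤ 1 := by
    have h1 : T - b ≤ 1 / (N + 1) := by linarith [(le_max_right _ _).trans hb1.le]
    calc N * (T - b) ≤ N * (1 / (N + 1)) := by gcongr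
      _ = N / (N + 1) := by ring
      _ ≤ 1 := (div_le_one (by positivity)).2 (by linarith)
  obtain ⟨c, hbc, hcT, hcx⟩ := exists_mem_Ioo_of_frequently hz hbT
  set φ : ℝ → ℝ := fun t => 1 + N * (t - b) with hφ
  -- The weight is chosen so that `vx` drops out: with `f` the reduced force, `Q' = φ f + (μ N - κ
  -- φ) x`. As `φ ≤ 2` and `μ N = 2 |κ|`, the last term is nonnegative, so `Q' > 0`. At impacts `Q`
  -- jumps upwards.
  set Q : ℝ → ℝ := fun t => φ t * ((m t).vx + μ * (m t).x) - N * (m t).x with hQ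
  have hφd : ∀ t s, HasDerivWithinAt φ N s t := by
    intro t s
    have := (((hasDerivWithinAt_id t s).sub_const b).const_mul N).const_add 1
    exact this.congr_deriv (by simp)
  have hQd : ∀ t, b ≤ t → t < T → ∃ d, 0 < d ∧ HasDerivWithinAt Q d (Set.Ici t) t := by
    intro t h1 h2
    have hg := h.germRight_coe (hb0.trans h1) h2
    have hft : 0 < (m t).reducedForce μ γ := ha' ⟨hab.trans_le h1, h2⟩
    have hs : ¬ (m t).Sticks μ γ := by
      rintro ⟨h3, -, h4⟩
      have : (m t).reducedForce μ γ = (m t).contactForce μ γ := by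
        simp [BallState.reducedForce, h3]
      rcases h4 with h4 | h4 <;> linarith
    refine ⟨_, ?_, ((hφd t _).mul ((hg.hasDeriv_vx hs).add (hg.hasDeriv_x.const_mul μ))).sub
      (hg.hasDeriv_x.const_mul N)⟩
    rw [BallState.lowerAccel_eq_reducedForce, ← hκ]
    have h5 : 1 ≤ φ t := by
      have : 0 ≤ N * (t - b) := mul_nonneg hN0 (by linarith)
      simp only [hφ]; linarith
    have h6 : φ t ≤ 2 := by
      have : N * (t - b) ≤ N * (T - b) := by gcongr
      simp only [hφ]; linarith
    have h7 : κ * φ t ≤ μ * N := by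
      rw [hNμ]
      calc κ * φ t ≤ |κ| * φ t := by gcongr; exact le_abs_self κ
        _ ≤ |κ| * 2 := by gcongr
        _ = 2 * |κ| := mul_comm _ _
    have h8 := mul_nonneg (sub_nonneg.2 h7) hg.nonneg
    have h9 : 0 < φ t * (m t).reducedForce μ γ := by positivity
    simp only [Pi.add_apply]
    nlinarith
  have hQl : ∀ t, b < t → t < T → ∃ l, l ≤ Q t ∧ Tendsto Q (𝓝[<] t) (𝓝 l) := by
    intro t h1 h2
    have hg := h.germLeft_coe (hb0.trans_lt h1) h2
    have hr := h.germRight_coe (hb0.trans h1.le) h2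
    have hφt : Tendsto φ (𝓝[<] t) (𝓝 (φ t)) :=
      (by fun_prop : Continuous φ).continuousWithinAt
    have hφ0 : 0 ≤ φ t := by
      have : 0 ≤ N * (t - b) := mul_nonneg hN0 (by linarith)
      simp only [hφ]; linarith
    rcases hr.nonneg.eq_or_lt with h0 | h0
    · refine ⟨_, ?_, (hφt.mul ((hg.impact h0.symm).add (hg.x.const_mul μ))).sub
        (hg.x.const_mul N)⟩
      have := mul_nonneg hφ0 (hr.vx_nonneg h0.symm)
      simp only [hQ]
      nlinarith
    · exact ⟨_, le_rfl, (hφt.mul ((hg.vx h0).add (hg.x.const_mul μ))).sub (hg.x.const_mul N)⟩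
  have hQb : 0 ≤ Q b := by
    have := (h.germRight_coe hb0 hbT).vx_nonneg hbx
    simpa [hQ, hφ, hbx] using this
  obtain ⟨e, hbe, hec, hQe⟩ : ∃ e, b < e ∧ e < c ∧ 0 < Q e := by
    obtain ⟨d, hd0, hd⟩ := hQd b le_rfl hbT
    have h1 := (hasDerivWithinAt_iff_tendsto_slope' (by simp : b ∉ Set.Ioi b)).1
      (hd.mono Set.Ioi_subset_Ici_self)
    obtain ⟨s, h2, h3⟩ := ((h1.eventually (lt_mem_nhds hd0)).and (Ioo_mem_nhdsGT hbc)).exists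
    have h3 : s ∈ Set.Ioo b c := h3
    rw [slope_def_field, lt_div_iff₀ (by linarith [h3.1])] at h2
    exact ⟨s, h3.1, h3.2, by linarith⟩
  have hg := h.germLeft_coe (hb0.trans_lt hbc) hcT
  have hφc : Tendsto φ (𝓝[<] c) (𝓝 (φ c)) :=
    (by fun_prop : Continuous φ).continuousWithinAt
  -- Just before the later contact `c`, the value of `Q` approaches `-φ(c) vx(c) ≤ 0`, although `Q ≥
  -- Q e > 0` from `e` on.
  have hlim : Tendsto Q (𝓝[<] c) (𝓝 _) :=
    (hφc.mul ((hg.impact hcx).add (hg.x.const_mul μ))).sub (hg.x.const_mul N)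
  have hge := ge_of_tendsto hlim (b := Q e) (by
    filter_upwards [Ioo_mem_nhdsLT hec] with s hs
    refine le_of_rightDeriv_nonneg_of_jumps hs.1.le (fun t h1 h2 => ?_) (fun t h1 h2 => ?_)
    · obtain ⟨d, hd, hd'⟩ := hQd t (hbe.le.trans h1) (h2.trans (hs.2.trans hcT))
      exact ⟨d, hd.le, hd'⟩
    · exact hQl t (hbe.trans h1) (h2.trans_lt (hs.2.trans hcT)))
  rw [hcx] at hge
  have h1 := (h.germRight_coe (hb0.trans hbc.le) hcT).vx_nonneg hcx
  have h2 : 0 ≤ φ c := by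
    have : 0 ≤ N * (c - b) := mul_nonneg hN0 (by linarith)
    simp only [hφ]; linarith
  have := mul_nonneg h2 h1
  nlinarith

end Accumulation

/-! ### Negative reduced force: the bounce energy -/

/-- A Lyapunov function for the lower mass when the reduced force is negative. -/
noncomputable def BallState.bounceEnergy (μ γ : ℝ) (u : BallState) : ℝ :=
  u.vx ^ 2 / 2 + u.x ^ 2 / 2 - u.reducedForce μ γ * u.x

lemma GermRight.hasDeriv_bounceEnergy {μ γ : ℝ} {m : ℝ → BallState} {t : ℝ}
    (h : GermRight μ γ m t) :
    HasDerivWithinAt (fun s => (m s).bounceEnergy μ γ)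
      (-μ * (m t).vx ^ 2 + (1 - (1 / 2 - μ ^ 2)) * ((m t).x * (m t).vx) -
        (m t).reducedForceRate μ γ * (m t).x) (Set.Ici t) t := by
  refine (((h.hasDeriv_vx_sq.div_const 2).add ((h.hasDeriv_x.pow 2).div_const 2)).sub
    (h.hasDeriv_reducedForce.mul h.hasDeriv_x)).congr_deriv ?_
  rw [BallState.lowerAccel_eq_reducedForce]
  push_cast
  ring

lemma GermLeft.bounceEnergy {μ γ : ℝ} {m : ℝ → BallState} {t : ℝ} (h : GermLeft μ γ m t)
    (h0 : 0 ≤ (m t).x) :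
    Tendsto (fun s => (m s).bounceEnergy μ γ) (𝓝[<] t) (𝓝 ((m t).bounceEnergy μ γ)) :=
  (((h.vx_sq h0).div_const 2).add ((h.x.pow 2).div_const 2)).sub (h.reducedForce.mul h.x)

lemma hasDerivWithinAt_exp_mul (c t : ℝ) (s : Set ℝ) :
    HasDerivWithinAt (fun t => Real.exp (c * t)) (Real.exp (c * t) * c) s t :=
  (HasDerivWithinAt.const_mul_id c t s).exp

section Bounce

variable {μ γ T : ℝ} {u : BallState} {m : ℝ → BallState}

/-- The rate constant for the growth and decay of the bounce energy. -/
noncomputable def bounceRate (μ K : ℝ) : ℝ := 2 * μ + |1 - (1 / 2 - μ ^ 2)| + K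

/-- The left side is the derivative of the bounce energy along a motion. Because `x ≥ 0` and the
force is negative, all parts of the bounce energy are nonnegative and control `x vx` and, through
`K`, the term with the force rate. -/
lemma bounceEnergy_growth (hμ : 0 < μ) {K : ℝ} {v : BallState} (hx : 0 ≤ v.x)
    (hf : v.reducedForce μ γ < 0)
    (hG : -v.reducedForceRate μ γ ≤ K * -v.reducedForce μ γ) (hK : 0 ≤ K) :
    -μ * v.vx ^ 2 + (1 - (1 / 2 - μ ^ 2)) * (v.x * v.vx) - v.reducedForceRate μ γ * v.x ≤
      bounceRate μ K * v.bounceEnergy μ γ := by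
  unfold bounceRate BallState.bounceEnergy
  generalize v.reducedForce μ γ = f at *
  generalize v.reducedForceRate μ γ = G at *
  generalize 1 - (1 / 2 - μ ^ 2) = k at *
  have h1 : k * (v.x * v.vx) ≤ |k| * (v.vx ^ 2 / 2 + v.x ^ 2 / 2) := by
    calc k * (v.x * v.vx) ≤ |k * (v.x * v.vx)| := le_abs_self _
      _ = |k| * |v.x * v.vx| := abs_mul _ _
      _ ≤ |k| * (v.vx ^ 2 / 2 + v.x ^ 2 / 2) := by
        refine mul_le_mul_of_nonneg_left ?_ (abs_nonneg _)
        rw [abs_le]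
        constructor <;> nlinarith [sq_nonneg (v.x + v.vx), sq_nonneg (v.x - v.vx)]
  have h2 : -G * v.x ≤ K * (-f * v.x) := by
    calc -G * v.x ≤ K * -f * v.x := by gcongr
      _ = _ := by ring
  have h3 : 0 ≤ -f * v.x := mul_nonneg (by linarith) hx
  have h4 := mul_nonneg (abs_nonneg k) h3
  have h5 := mul_nonneg hμ.le h3
  have h6 := mul_nonneg hμ.le (sq_nonneg v.vx)
  have h7 := mul_nonneg hμ.le (sq_nonneg v.x)
  have h8 := mul_nonneg hK (sq_nonneg v.vx)
  have h9 := mul_nonneg hK (sq_nonneg v.x)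
  nlinarith

/-- Up to a positive factor, this is the derivative of `exp (C t) H / (-f)` for the bounce energy
`H`, the force `f` and `C = bounceRate μ K`. The products of `f`, its rate `G` and `x` cancel; the
remaining term `(vx²/2 + x²/2) G` is absorbed by the hypothesis on `G`. -/
lemma bounceEnergy_decay (hμ : 0 < μ) {K : ℝ} {v : BallState} (hx : 0 ≤ v.x)
    (hf : v.reducedForce μ γ < 0)
    (hG : -v.reducedForceRate μ γ ≤ K * -v.reducedForce μ γ) (hK : 0 ≤ K) :
    0 ≤ bounceRate μ K * v.bounceEnergy μ γ * -v.reducedForce μ γ +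
      (-μ * v.vx ^ 2 + (1 - (1 / 2 - μ ^ 2)) * (v.x * v.vx) - v.reducedForceRate μ γ * v.x) *
        -v.reducedForce μ γ + v.bounceEnergy μ γ * v.reducedForceRate μ γ := by
  unfold bounceRate BallState.bounceEnergy
  generalize v.reducedForce μ γ = f at *
  generalize v.reducedForceRate μ γ = G at *
  generalize 1 - (1 / 2 - μ ^ 2) = k at *
  obtain ⟨g, rfl⟩ : ∃ g, f = -g := ⟨-f, by ring⟩
  rw [neg_neg] at *
  have hg : 0 < g := by linarith
  set q := v.vx ^ 2 / 2 + v.x ^ 2 / 2 with hq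
  have hq0 : 0 ≤ q := by positivity
  have h1 : -(|k| * q) ≤ k * (v.x * v.vx) := by
    have : |k * (v.x * v.vx)| ≤ |k| * q := by
      rw [abs_mul]
      refine mul_le_mul_of_nonneg_left ?_ (abs_nonneg _)
      rw [abs_le]
      constructor <;> nlinarith [sq_nonneg (v.x + v.vx), sq_nonneg (v.x - v.vx)]
    exact (abs_le.1 this).1
  have h3 : 0 ≤ g * v.x := mul_nonneg hg.le hx
  have h2 : 0 ≤ q * (G + K * g) := mul_nonneg hq0 (by linarith)
  have hA : 0 ≤ 2 * μ * (q + g * v.x) - μ * v.vx ^ 2 := by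
    have h5 := mul_nonneg hμ.le h3
    have h7 := mul_nonneg hμ.le (sq_nonneg v.x)
    nlinarith
  have hB : 0 ≤ |k| * (q + g * v.x) + k * (v.x * v.vx) := by
    have := mul_nonneg (abs_nonneg k) h3
    linarith
  have hAB := mul_nonneg (add_nonneg hA hB) hg.le
  have hC := mul_nonneg (mul_nonneg hK h3) hg.le
  have e : (2 * μ + |k| + K) * (q - -g * v.x) * g +
      (-μ * v.vx ^ 2 + k * (v.x * v.vx) - G * v.x) * g + (q - -g * v.x) * G =
      (2 * μ * (q + g * v.x) - μ * v.vx ^ 2 + (|k| * (q + g * v.x) + k * (v.x * v.vx))) * g +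
      q * (G + K * g) + K * (g * v.x) * g := by ring
  rw [e]
  linarith

set_option maxHeartbeats 800000 in
/-- Where the reduced force is negative, a motion with floor contacts up to the end of the time
interval ends in persistent contact. -/
lemma IsMotion.eventually_contact_of_reducedForce_neg (hμ : 0 < μ) (hγ : 0 < γ) (hT : 0 < T)
    (h : IsMotion μ γ T u m) {K : ℝ} (hK : 0 ≤ K)
    (hp : ∀ᶠ t in 𝓝[<] T, (m t).reducedForce μ γ < 0 ∧
      -(m t).reducedForceRate μ γ ≤ K * -(m t).reducedForce μ γ)
    (hz : ∃ᶠ t in 𝓝[<] T, (m t).x = 0) : ∀ᶠ t in 𝓝[<] T, ContactAt μ γ m t := by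
  obtain ⟨M, hM, hb⟩ := h.exists_bound hμ hγ
  obtain ⟨a, ha, ha'⟩ := mem_nhdsLT_iff_exists_Ioo_subset.1 hp
  have ha : a < T := ha
  obtain ⟨b, hb1, hbT, hbx⟩ := exists_mem_Ioo_of_frequently hz (max_lt ha hT)
  have hb0 : 0 < b := (le_max_right _ _).trans_lt hb1
  have hf : ∀ t, b ≤ t → t < T → (m t).reducedForce μ γ < 0 := fun t h1 h2 =>
    (ha' ⟨((le_max_left _ _).trans_lt hb1).trans_le h1, h2⟩).1
  have hG : ∀ t, b ≤ t → t < T →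
      -(m t).reducedForceRate μ γ ≤ K * -(m t).reducedForce μ γ := fun t h1 h2 =>
    (ha' ⟨((le_max_left _ _).trans_lt hb1).trans_le h1, h2⟩).2
  have hr : ∀ t, b ≤ t → t < T → GermRight μ γ m t := fun t h1 h2 =>
    h.germRight_coe (hb0.le.trans h1) h2
  have hl : ∀ t, b ≤ t → t < T → GermLeft μ γ m t := fun t h1 h2 =>
    h.germLeft_coe (hb0.trans_le h1) h2
  set C := bounceRate μ K with hC
  have hC0 : 0 ≤ C := by
    rw [hC]; unfold bounceRate; positivity
  have hup : ∀ s t, b ≤ s → s ≤ t → t < T →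
      (m t).bounceEnergy μ γ ≤ Real.exp (C * (t - s)) * (m s).bounceEnergy μ γ := by
    intro s t h1 h2 h3
    have := le_of_rightDeriv_nonneg
      (φ := fun t => -(Real.exp ((-C) * t) * (m t).bounceEnergy μ γ)) h2
      (fun r h4 h5 => ⟨_, ?_, ((hasDerivWithinAt_exp_mul (-C) r _).mul
        (hr r (h1.trans h4) (h5.trans h3)).hasDeriv_bounceEnergy).neg⟩)
      (fun r h4 h5 => (ContinuousWithinAt.mul (by fun_prop)
        ((hl r (h1.trans h4.le) (h5.trans_lt h3)).bounceEnergy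
          (hr r (h1.trans h4.le) (h5.trans_lt h3)).nonneg)).neg)
    · have e1 := Real.exp_pos (C * t)
      have e2 : Real.exp (C * t) * Real.exp ((-C) * t) = 1 := by
        rw [← Real.exp_add]; simp
      have e3 : Real.exp (C * t) * Real.exp ((-C) * s) = Real.exp (C * (t - s)) := by
        rw [← Real.exp_add]; ring_nf
      have := mul_le_mul_of_nonneg_left this e1.le
      rw [← e3]
      linear_combination this - e2 * (m t).bounceEnergy μ γ
    · have h6 := h1.trans h4
      have h7 := h5.trans h3
      have := bounceEnergy_growth (γ := γ) hμ (hr r h6 h7).nonneg (hf r h6 h7) (hG r h6 h7) hK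
      have := mul_le_mul_of_nonneg_left this (Real.exp_pos ((-C) * r)).le
      rw [← hC] at this
      linear_combination this
  have hmix : ∀ t, b ≤ t → t < T → 0 ≤ -(m t).reducedForce μ γ * (m t).x := fun t h1 h2 =>
    mul_nonneg (by linarith [hf t h1 h2]) (hr t h1 h2).nonneg
  -- If the mass is ever at rest on the floor, the bounce energy is zero there and stays zero by
  -- `hup`, which means contact until `T`. Otherwise every contact is an impact with positive speed,
  -- and this is refuted.
  by_cases hrest : ∃ c, b ≤ c ∧ c < T ∧ (m c).x = 0 ∧ (m c).vx = 0
  · obtain ⟨c, hbc, hcT, hcx, hcv⟩ := hrest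
    have hzero : ∀ t, c ≤ t → t < T → (m t).x = 0 ∧ (m t).vx = 0 := by
      intro t h1 h2
      have h3 := hup c t hbc h1 h2
      have h4 : (m c).bounceEnergy μ γ = 0 := by simp [BallState.bounceEnergy, hcx, hcv]
      rw [h4, mul_zero] at h3
      have h5 := hmix t (hbc.trans h1) h2
      unfold BallState.bounceEnergy at h3
      exact ⟨pow_eq_zero_iff two_ne_zero |>.1 (by nlinarith [sq_nonneg (m t).x, sq_nonneg (m t).vx]),
        pow_eq_zero_iff two_ne_zero |>.1 (by nlinarith [sq_nonneg (m t).x, sq_nonneg (m t).vx])⟩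
    filter_upwards [Ioo_mem_nhdsLT hcT] with t ht
    refine h.contactAt_of_zero (mem_timeDomain_coe.2 ⟨hb0.le.trans (hbc.trans ht.1.le), ht.2⟩)
      (hb0.trans_le (hbc.trans ht.1.le)) (hzero t ht.1.le ht.2).1 (hzero t ht.1.le ht.2).2 ?_
    filter_upwards [Ioo_mem_nhdsLT ht.1] with s hs
    exact (hzero s hs.1.le (hs.2.trans ht.2)).1
  · exfalso
    push Not at hrest
    have hvpos : ∀ c, b ≤ c → c < T → (m c).x = 0 → 0 < (m c).vx := fun c h1 h2 h3 =>
      ((hr c h1 h2).vx_nonneg h3).lt_of_ne (hrest c h1 h2 h3).symm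
    have hdown : ∀ t, b ≤ t → t < T →
        Real.exp (C * b) * (m b).bounceEnergy μ γ / -(m b).reducedForce μ γ ≤
        Real.exp (C * t) * (m t).bounceEnergy μ γ / -(m t).reducedForce μ γ := by
      intro t h2 h3
      refine le_of_rightDeriv_nonneg
        (φ := fun t => Real.exp (C * t) * (m t).bounceEnergy μ γ / -(m t).reducedForce μ γ) h2
        (fun r h4 h5 => ⟨_, ?_, ((hasDerivWithinAt_exp_mul C r _).mul
          (hr r h4 (h5.trans h3)).hasDeriv_bounceEnergy).div
          (hr r h4 (h5.trans h3)).hasDeriv_reducedForce.neg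
          (by have := hf r h4 (h5.trans h3); linarith)⟩)
        (fun r h4 h5 => ContinuousWithinAt.div (ContinuousWithinAt.mul (by fun_prop)
          ((hl r h4.le (h5.trans_lt h3)).bounceEnergy (hr r h4.le (h5.trans_lt h3)).nonneg))
          (hl r h4.le (h5.trans_lt h3)).reducedForce.neg
          (by have := hf r h4.le (h5.trans_lt h3); linarith))
      have h7 := h5.trans h3
      refine div_nonneg ?_ (sq_nonneg _)
      have := bounceEnergy_decay (γ := γ) hμ (hr r h4 h7).nonneg (hf r h4 h7) (hG r h4 h7) hK
      have := mul_nonneg (Real.exp_pos (C * r)).le this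
      rw [← hC] at this
      simp only [Pi.mul_apply]
      linarith
    set c₀ := Real.exp (C * b) * (m b).bounceEnergy μ γ / -(m b).reducedForce μ γ with hc₀
    have hc₀pos : 0 < c₀ := by
      have h1 := hvpos b le_rfl hbT hbx
      have h2 := hf b le_rfl hbT
      refine div_pos (mul_pos (Real.exp_pos _) ?_) (by linarith)
      simp only [BallState.bounceEnergy, hbx]
      nlinarith
    set A := Real.exp (C * T) with hA
    set B := Real.exp (K * T) with hB
    have hA1 : 1 ≤ A := Real.one_le_exp (by positivity)
    have hB1 : 1 ≤ B := Real.one_le_exp (by positivity)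
    -- `D p` will bound the acceleration after an impact at speed `p`: the first summand bounds the
    -- force, the second the terms with `vx` and `x`.
    set D := B * (A * M / (2 * c₀)) + (μ + |1 / 2 - μ ^ 2|) * A with hD
    have hD0 : 0 < D := by positivity
    have hlt : max b (T - 1 / (2 * D)) < T :=
      max_lt hbT (by linarith [show 0 < 1 / (2 * D) by positivity])
    obtain ⟨c, hc1, hcT, hcx⟩ := exists_mem_Ioo_of_frequently hz hlt
    have hbc : b < c := (le_max_left _ _).trans_lt hc1
    have hcD : D * (T - c) ≤ 1 / 2 := by
      have h1 : T - c ≤ 1 / (2 * D) := by linarith [(le_max_right _ _).trans hc1.le]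
      calc D * (T - c) ≤ D * (1 / (2 * D)) := by gcongr
        _ = 1 / 2 := by field_simp
    set p := (m c).vx with hpdef
    have hp0 : 0 < p := hvpos c hbc.le hcT hcx
    have hpM : p ≤ M := (le_abs_self p).trans
      (hb c (mem_timeDomain_coe.2 ⟨hb0.le.trans hbc.le, hcT⟩)).2.1
    have hHc : (m c).bounceEnergy μ γ = p ^ 2 / 2 := by
      simp [BallState.bounceEnergy, hcx, hpdef]
    -- At the impact the bounce energy is `p² / 2`, and by `hdown` its ratio to the force is bounded
    -- below. So the force is at most of order `p²`, and `p ≤ M` makes the bound linear in `p`.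
    have hgc : -(m c).reducedForce μ γ ≤ A * M / (2 * c₀) * p := by
      have h1 := hdown c hbc.le hcT
      have h2 := hf c hbc.le hcT
      rw [hHc, le_div_iff₀ (by linarith)] at h1
      have h3 : Real.exp (C * c) ≤ A := Real.exp_le_exp.2 (by gcongr)
      have h4 : Real.exp (C * c) * (p ^ 2 / 2) ≤ A * (M * p / 2) := by
        gcongr
        nlinarith
      rw [div_mul_eq_mul_div, le_div_iff₀ (by positivity)]
      linarith
    have hgt : ∀ t, c ≤ t → t < T → -(m t).reducedForce μ γ ≤ B * (A * M / (2 * c₀) * p) := by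
      intro t h1 h2
      have := le_of_rightDeriv_nonneg
        (φ := fun t => Real.exp ((-K) * t) * (m t).reducedForce μ γ) h1
        (fun r h4 h5 => ⟨_, ?_, (hasDerivWithinAt_exp_mul (-K) r _).mul
          (hr r (hbc.le.trans h4) (h5.trans h2)).hasDeriv_reducedForce⟩)
        (fun r h4 h5 => ContinuousWithinAt.mul (by fun_prop)
          (hl r (hbc.le.trans h4.le) (h5.trans_lt h2)).reducedForce)
      · have e1 := Real.exp_pos (K * t)
        have e2 : Real.exp (K * t) * Real.exp ((-K) * t) = 1 := by
          rw [← Real.exp_add]; simp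
        have e3 : Real.exp (K * t) * Real.exp ((-K) * c) = Real.exp (K * (t - c)) := by
          rw [← Real.exp_add]; ring_nf
        have h6 : -(m t).reducedForce μ γ ≤ Real.exp (K * (t - c)) * -(m c).reducedForce μ γ := by
          have := mul_le_mul_of_nonneg_left this e1.le
          rw [← e3]
          linear_combination this + e2 * (m t).reducedForce μ γ
        have h7 : Real.exp (K * (t - c)) ≤ B := by
          refine Real.exp_le_exp.2 ?_
          gcongr
          linarith
        refine h6.trans (mul_le_mul h7 hgc ?_ (by linarith))
        linarith [hf c hbc.le hcT]
      · have h6 := hG r (hbc.le.trans h4) (h5.trans h2)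
        have := mul_le_mul_of_nonneg_left h6 (Real.exp_pos ((-K) * r)).le
        linarith
    have hsmall : ∀ t, c ≤ t → t < T → |(m t).vx| ≤ A * p ∧ |(m t).x| ≤ A * p := by
      intro t h1 h2
      have h3 := hup c t hbc.le h1 h2
      have h4 := hmix t (hbc.le.trans h1) h2
      have h5 : Real.exp (C * (t - c)) ≤ A := by
        refine Real.exp_le_exp.2 ?_
        gcongr
        linarith
      have h6 : Real.exp (C * (t - c)) * (p ^ 2 / 2) ≤ A * (p ^ 2 / 2) := by gcongr
      rw [hHc] at h3
      unfold BallState.bounceEnergy at h3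
      have h7 : A * p ^ 2 ≤ (A * p) ^ 2 := by
        nlinarith [mul_nonneg (mul_nonneg (by linarith : 0 ≤ A) (sub_nonneg.2 hA1)) (sq_nonneg p)]
      constructor
      · refine abs_le_of_sq_le_sq ?_ (by positivity)
        linarith [sq_nonneg (m t).x]
      · refine abs_le_of_sq_le_sq ?_ (by positivity)
        linarith [sq_nonneg (m t).vx]
    have hacc : ∀ t, c ≤ t → t < T → |(m t).lowerAccel μ γ| ≤ D * p := by
      intro t h1 h2
      obtain ⟨h3, h4⟩ := hsmall t h1 h2
      have h5 := hgt t h1 h2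
      have h6 := hf t (hbc.le.trans h1) h2
      rw [BallState.lowerAccel_eq_reducedForce]
      calc |(m t).reducedForce μ γ - μ * (m t).vx - (1 / 2 - μ ^ 2) * (m t).x|
          ≤ |(m t).reducedForce μ γ| + |μ * (m t).vx| + |(1 / 2 - μ ^ 2) * (m t).x| :=
            (abs_sub _ _).trans (by gcongr; exact abs_sub _ _)
        _ ≤ B * (A * M / (2 * c₀) * p) + μ * (A * p) + |1 / 2 - μ ^ 2| * (A * p) := by
            rw [abs_mul, abs_mul, abs_of_pos hμ, abs_of_neg h6]
            gcongr
        _ = D * p := by rw [hD]; ring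
    -- The remaining time is at most `1 / (2 D)`, so an acceleration bounded by `D p` leaves the
    -- velocity at least `p / 2`. Then `x` is positive at the supposed later contact `d`.
    obtain ⟨d, hcd, hdT, hdx⟩ := exists_mem_Ioo_of_frequently hz hcT
    have hc0 : 0 ≤ c := hb0.le.trans hbc.le
    have := h.x_add_le (δ := p / 2) hc0 hcd.le hdT (fun t h1 h2 => by
      have h3 := h.vx_sub_le hc0 h1 (h2.trans hdT) (fun s h4 h5 => hacc s h4
        (h5.trans (h2.trans hdT)))
      have h6 : D * p * (t - c) ≤ p / 2 := by
        calc D * p * (t - c) ≤ D * p * (T - c) := by gcongr; linarith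
          _ = D * (T - c) * p := by ring
          _ ≤ 1 / 2 * p := by gcongr
          _ = p / 2 := by ring
      linarith)
    rw [hcx, hdx] at this
    have : 0 < p / 2 * (d - c) := mul_pos (by linarith) (by linarith)
    linarith

/-- Impacts, grazings and changes between flight and contact do not accumulate at a finite time. -/
lemma IsMotion.phase_end (hμ : 0 < μ) (hγ : 0 < γ) (hT : 0 < T) (h : IsMotion μ γ T u m) :
    (∀ᶠ t in 𝓝[<] T, ContactAt μ γ m t) ∨ (∀ᶠ t in 𝓝[<] T, FlightAt μ γ m t) := by
  by_cases hz : ∃ᶠ t in 𝓝[<] T, (m t).x = 0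
  · left
    rcases h.reducedForce_sign hμ hγ hT hz with hp | ⟨K, hK, hp⟩
    · exact absurd hz (h.not_frequently_zero_of_reducedForce_pos hμ hT hp)
    · exact h.eventually_contact_of_reducedForce_neg hμ hγ hT hK hp hz
  · right
    filter_upwards [not_frequently.1 hz, Ioo_mem_nhdsLT hT] with t h1 h2
    have ht : t ∈ timeDomain (T : EReal) := mem_timeDomain_coe.2 ⟨h2.1.le, h2.2⟩
    exact h.flightAt_of_pos ht h2.1 ((h.nonneg t ht).lt_of_ne (Ne.symm h1))

end Bounce

/-! ### Existence: local continuation and gluing -/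

/-- Local solutions of the equations of motion of the free ball (`c = 1`) and of the ball whose
lower mass is held fixed (`c = 0`). -/
lemma exists_local_solution (c μ γ : ℝ) (u : BallState) (t₀ : ℝ) :
    ∃ (m : ℝ → BallState) (ε : ℝ), 0 < ε ∧ m t₀ = u ∧ ∀ t ∈ Set.Ioo (t₀ - ε) (t₀ + ε),
      HasDerivAt (fun s => (m s).x) (c * (m t).vx) t ∧
      HasDerivAt (fun s => (m s).vx) (c * (m t).lowerAccel μ γ) t ∧
      HasDerivAt (fun s => (m s).y) (m t).vy t ∧
      HasDerivAt (fun s => (m s).vy) ((m t).upperAccel μ γ) t := by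
  set st : ℝ × ℝ × ℝ × ℝ → BallState := fun p => ⟨p.1, p.2.1, p.2.2.1, p.2.2.2⟩ with hst
  set v : ℝ × ℝ × ℝ × ℝ → ℝ × ℝ × ℝ × ℝ := fun p =>
    (c * (st p).vx, c * (st p).lowerAccel μ γ, (st p).vy, (st p).upperAccel μ γ) with hv
  have hvC : ContDiff ℝ 1 v := by
    simp only [hv, hst, BallState.lowerAccel, BallState.upperAccel]
    fun_prop
  obtain ⟨α, hα0, ε, hε, hα⟩ :=
    (hvC.contDiffAt (x := (u.x, u.vx, u.y, u.vy))
      ).exists_forall_mem_closedBall_exists_eq_forall_mem_Ioo_hasDerivAt₀ t₀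
  refine ⟨fun t => st (α t), ε, hε, by simp [hst, hα0], fun t ht => ?_⟩
  have h := hα t ht
  exact ⟨h.fst, h.snd.fst, h.snd.snd.fst, h.snd.snd.snd⟩

lemma GermRight.of_tendsto {μ γ : ℝ} {m : ℝ → BallState} {t : ℝ} (h0 : 0 ≤ (m t).x)
    (h1 : ContinuousAt (fun s => (m s).x) t) (h2 : ContinuousAt (fun s => (m s).vx) t)
    (h3 : ContinuousAt (fun s => (m s).y) t) (h4 : ContinuousAt (fun s => (m s).vy) t)
    (h5 : ((m t).Sticks μ γ ∧ ∀ᶠ s in 𝓝[>] t, ContactAt μ γ m s) ∨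
      (¬ (m t).Sticks μ γ ∧ ∀ᶠ s in 𝓝[>] t, FlightAt μ γ m s)) : GermRight μ γ m t :=
  ⟨h0, h1.mono_left nhdsWithin_le_nhds, h2.mono_left nhdsWithin_le_nhds,
    h3.mono_left nhdsWithin_le_nhds, h4.mono_left nhdsWithin_le_nhds, h5⟩

/-- The free solution rises because the first nonzero entry among `x`, `vx`, acceleration and jerk
is positive. At rest on the floor, the last two are `F` and, if `F = 0`, `Ḟ`, so this is exactly the
failure of sticking. -/
lemma exists_right_flight {μ γ : ℝ} {u : BallState} (hx : 0 ≤ u.x)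
    (hv : u.x = 0 → 0 ≤ u.vx) (hs : ¬ u.Sticks μ γ) (t₀ : ℝ) :
    ∃ (m : ℝ → BallState) (b : ℝ), t₀ < b ∧ m t₀ = u ∧ GermRight μ γ m t₀ ∧
      ∀ t ∈ Set.Ioo t₀ b, GermRight μ γ m t ∧ GermLeft μ γ m t := by
  obtain ⟨m, ε, hε, hm0, hm⟩ := exists_local_solution 1 μ γ u t₀
  simp only [one_mul] at hm
  have hev : ∀ᶠ t in 𝓝 t₀, t ∈ Set.Ioo (t₀ - ε) (t₀ + ε) :=
    Ioo_mem_nhds (by linarith) (by linarith)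
  have hm' := hev.mono hm
  obtain ⟨d1, d2, d3, d4⟩ := hm'.self_of_nhds
  have hacc : ∀ᶠ t in 𝓝 t₀, HasDerivAt (fun s => (m s).lowerAccel μ γ)
      ((m t).vy / 2 + μ * (m t).upperAccel μ γ - μ * (m t).lowerAccel μ γ - (m t).vx / 2) t := by
    filter_upwards [hm'] with t ht
    obtain ⟨e1, e2, e3, e4⟩ := ht
    exact ((((e3.div_const 2).const_add _).add (e4.const_mul μ)).sub (e2.const_mul μ)).sub
      (e1.div_const 2)
  have hpos : ∀ᶠ t in 𝓝[>] t₀, 0 < (m t).x := by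
    rcases hx.eq_or_lt with h0 | h0
    · have hstep : (∀ᶠ t in 𝓝[>] t₀, 0 < (m t).vx) → ∀ᶠ t in 𝓝[>] t₀, 0 < (m t).x :=
        eventually_pos_right_of_deriv (by rw [hm0]; exact hx) (hm'.mono fun t ht => ht.1)
      refine hstep ?_
      rcases (hv h0.symm).eq_or_lt with h1 | h1
      · have hstep2 : (∀ᶠ t in 𝓝[>] t₀, 0 < (m t).lowerAccel μ γ) →
            ∀ᶠ t in 𝓝[>] t₀, 0 < (m t).vx :=
          eventually_pos_right_of_deriv (by rw [hm0]; exact hv h0.symm)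
            (hm'.mono fun t ht => ht.2.1)
        refine hstep2 ?_
        have hF : u.lowerAccel μ γ = u.contactForce μ γ := by
          simp only [BallState.lowerAccel, BallState.contactForce, ← h0, ← h1]; ring
        have hcases : 0 < u.contactForce μ γ ∨
            (u.contactForce μ γ = 0 ∧ 0 < u.contactForceRate μ γ) := by
          by_contra! hcon
          refine hs ⟨h0.symm, h1.symm, ?_⟩
          rcases hcon.1.lt_or_eq with h2 | h2
          · exact Or.inl h2
          · exact Or.inr ⟨h2, hcon.2 h2⟩
        rcases hcases with h2 | ⟨h2, h3⟩
        · have := hacc.self_of_nhds.continuousAt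
          refine mem_nhdsWithin_of_mem_nhds (this.eventually (lt_mem_nhds ?_))
          beta_reduce
          rw [hm0, hF]; exact h2
        · refine eventually_pos_right_of_deriv (by rw [hm0, hF, h2]) hacc
            (mem_nhdsWithin_of_mem_nhds ?_)
          have hc : ContinuousAt (fun t => (m t).vy / 2 + μ * (m t).upperAccel μ γ -
              μ * (m t).lowerAccel μ γ - (m t).vx / 2) t₀ := by
            have c1 := d1.continuousAt
            have c2 := d2.continuousAt
            have c3 := d3.continuousAt
            have c4 := d4.continuousAt
            simp only [BallState.lowerAccel, BallState.upperAccel]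
            fun_prop
          refine hc.eventually (lt_mem_nhds ?_)
          beta_reduce
          rw [hm0, hF, h2, ← h1]
          simpa [BallState.contactForceRate] using h3
      · refine mem_nhdsWithin_of_mem_nhds (d2.continuousAt.eventually (lt_mem_nhds ?_))
        beta_reduce
        rw [hm0]; exact h1
    · refine mem_nhdsWithin_of_mem_nhds (d1.continuousAt.eventually (lt_mem_nhds ?_))
      beta_reduce
      rw [hm0]; exact h0
  have hfl : ∀ᶠ t in 𝓝[>] t₀, FlightAt μ γ m t := by
    filter_upwards [hpos, mem_nhdsWithin_of_mem_nhds hm'] with t h1 h2 using ⟨h1, h2⟩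
  obtain ⟨b, hb, hb'⟩ := mem_nhdsGT_iff_exists_Ioo_subset.1 (eventually_nhds_of_nhdsGT hfl)
  refine ⟨m, b, hb, hm0, GermRight.of_tendsto (by rw [hm0]; exact hx) d1.continuousAt
    d2.continuousAt d3.continuousAt d4.continuousAt (Or.inr ⟨by rwa [hm0], hfl⟩),
    fun t ht => germs_of_eventually_flight (hb' ht)⟩

/-- The solution with fixed lower mass must continue to satisfy the sticking rule, so `F < 0` is
needed right after `t₀`. In the borderline case `F = Ḟ = 0` this holds because the second derivative
of `F` is `-γ`. -/
lemma exists_right_contact {μ γ : ℝ} (hγ : 0 < γ) {u : BallState} (hs : u.Sticks μ γ)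
    (t₀ : ℝ) :
    ∃ (m : ℝ → BallState) (b : ℝ), t₀ < b ∧ m t₀ = u ∧ GermRight μ γ m t₀ ∧
      ∀ t ∈ Set.Ioo t₀ b, GermRight μ γ m t ∧ GermLeft μ γ m t := by
  obtain ⟨m, ε, hε, hm0, hm⟩ := exists_local_solution 0 μ γ u t₀
  simp only [zero_mul] at hm
  have hev : ∀ᶠ t in 𝓝 t₀, t ∈ Set.Ioo (t₀ - ε) (t₀ + ε) :=
    Ioo_mem_nhds (by linarith) (by linarith)
  have hm' := hev.mono hm
  obtain ⟨d1, d2, d3, d4⟩ := hm'.self_of_nhds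
  have hconst : ∀ φ : ℝ → ℝ, φ t₀ = 0 → (∀ t ∈ Set.Ioo (t₀ - ε) (t₀ + ε), HasDerivAt φ 0 t) →
      ∀ᶠ t in 𝓝[>] t₀, φ t = 0 := by
    intro φ h0 hφ
    filter_upwards [Ioo_mem_nhdsGT (by linarith : t₀ < t₀ + ε)] with t ht
    have := abs_sub_le_of_rightDeriv (φ := φ) (φ' := fun _ => 0) (K := 0) ht.1.le
      (fun s h1 h2 => ⟨(hφ s ⟨by linarith, h2.trans ht.2⟩).hasDerivWithinAt, by simp⟩)
      (fun s h1 h2 => (hφ s ⟨by linarith, h2.trans_lt ht.2⟩).continuousAt.continuousWithinAt)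
    rw [h0, zero_mul, sub_zero] at this
    exact abs_nonpos_iff.1 this
  have hx0 := hconst (fun t => (m t).x) (by rw [hm0]; exact hs.1) fun t ht => (hm t ht).1
  have hvx0 := hconst (fun t => (m t).vx) (by rw [hm0]; exact hs.2.1) fun t ht => (hm t ht).2.1
  have hF : ∀ᶠ t in 𝓝 t₀, HasDerivAt (fun s => (m s).contactForce μ γ)
      ((m t).contactForceRate μ γ) t := by
    filter_upwards [hm'] with t ht
    exact (((ht.2.2.1.div_const 2).add (ht.2.2.2.const_mul μ)).sub_const γ).sub_const (1 / 2)
  have hF' : ∀ᶠ t in 𝓝 t₀, HasDerivAt (fun s => (m s).contactForceRate μ γ)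
      ((m t).upperAccel μ γ / 2 + μ * (0 / 2 + μ * 0 - (m t).vy / 2 -
        μ * (m t).upperAccel μ γ)) t := by
    filter_upwards [hm'] with t ht
    obtain ⟨e1, e2, e3, e4⟩ := ht
    exact (e4.div_const 2).add (((((e1.div_const 2).const_add _).add (e2.const_mul μ)).sub
      (e3.div_const 2)).sub (e4.const_mul μ) |>.const_mul μ)
  have hneg : ∀ᶠ t in 𝓝[>] t₀, (m t).contactForce μ γ < 0 := by
    suffices hp : ∀ᶠ t in 𝓝[>] t₀, 0 < -(m t).contactForce μ γ from
      hp.mono fun t ht => by linarith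
    rcases hs.2.2 with h1 | ⟨h1, h2⟩
    · refine mem_nhdsWithin_of_mem_nhds
        (hF.self_of_nhds.continuousAt.neg.eventually (lt_mem_nhds ?_))
      rw [Pi.neg_apply]
      rw [hm0]; linarith
    · refine eventually_pos_right_of_deriv (g := fun t => -(m t).contactForce μ γ)
        (by rw [hm0, h1, neg_zero]) (hF.mono fun t ht => ht.neg) ?_
      rcases h2.lt_or_eq with h3 | h3
      · refine mem_nhdsWithin_of_mem_nhds
          (hF'.self_of_nhds.continuousAt.neg.eventually (lt_mem_nhds ?_))
        rw [Pi.neg_apply]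
        rw [hm0]; linarith
      · refine eventually_pos_right_of_deriv (g := fun t => -(m t).contactForceRate μ γ)
          (by rw [hm0, h3, neg_zero]) (hF'.mono fun t ht => ht.neg)
          (mem_nhdsWithin_of_mem_nhds ?_)
        have hc : ContinuousAt (fun t => -((m t).upperAccel μ γ / 2 + μ * (0 / 2 + μ * 0 -
            (m t).vy / 2 - μ * (m t).upperAccel μ γ))) t₀ := by
          have c1 := d1.continuousAt
          have c2 := d2.continuousAt
          have c3 := d3.continuousAt
          have c4 := d4.continuousAt
          simp only [BallState.upperAccel]
          fun_prop
        refine hc.eventually (lt_mem_nhds ?_)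
        beta_reduce
        rw [hm0]
        have h4 : u.upperAccel μ γ = -2 * γ := by
          simp only [BallState.contactForce] at h1
          simp only [BallState.upperAccel, hs.1, hs.2.1]
          linear_combination -h1
        simp only [BallState.contactForceRate] at h3
        rw [h4] at h3 ⊢
        linear_combination hγ - μ * h3
  have hco : ∀ᶠ t in 𝓝[>] t₀, ContactAt μ γ m t := by
    filter_upwards [hx0, hvx0, mem_nhdsWithin_of_mem_nhds hm'] with t h1 h2 h3
      using ⟨h1, h2, h3.2.2⟩
  obtain ⟨b, hb, hb'⟩ := mem_nhdsGT_iff_exists_Ioo_subset.1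
    ((eventually_nhds_of_nhdsGT hco).and hneg)
  refine ⟨m, b, hb, hm0, GermRight.of_tendsto (by rw [hm0]; exact hs.1.ge) d1.continuousAt
    d2.continuousAt d3.continuousAt d4.continuousAt (Or.inl ⟨by rwa [hm0], hco⟩),
    fun t ht => germs_of_eventually_contact (hb' ht).1 ?_⟩
  have := (hb' ht).1.self_of_nhds
  exact ⟨this.1, this.2.1, Or.inl (hb' ht).2⟩

lemma exists_right {μ γ : ℝ} (hγ : 0 < γ) {u : BallState} (hx : 0 ≤ u.x)
    (hv : u.x = 0 → 0 ≤ u.vx) (t₀ : ℝ) :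
    ∃ (m : ℝ → BallState) (b : ℝ), t₀ < b ∧ m t₀ = u ∧ GermRight μ γ m t₀ ∧
      ∀ t ∈ Set.Ioo t₀ b, GermRight μ γ m t ∧ GermLeft μ γ m t := by
  by_cases hs : u.Sticks μ γ
  · exact exists_right_contact hγ hs t₀
  · exact exists_right_flight hx hv hs t₀

section Extension

variable {μ γ : ℝ} {u : BallState}

lemma exists_motion_short (hγ : 0 < γ) (hu : 0 ≤ u.x) :
    ∃ T : ℝ, 0 < T ∧ ∃ m, IsMotion μ γ T u m := by
  obtain ⟨m, b, hb, hm0, hr, hm⟩ := exists_right (μ := μ) hγ (u := u.afterImpact) hu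
    (fun h => by simp only [BallState.afterImpact] at h ⊢; rw [if_pos h]; exact abs_nonneg _) 0
  refine ⟨b, hb, m, isMotion_iff_germs.2 ⟨hm0, fun t ht => ?_⟩⟩
  rw [mem_timeDomain_coe] at ht
  rcases ht.1.eq_or_lt with rfl | h0
  · exact ⟨hr, fun h => absurd h (lt_irrefl _)⟩
  · exact ⟨(hm t ⟨h0, ht.2⟩).1, fun _ => (hm t ⟨h0, ht.2⟩).2⟩

/-- By `phase_end` a single phase lasts up to `T`: in contact `vx` is zero, in flight it is
Lipschitz since the acceleration is bounded. -/
lemma IsMotion.exists_tendsto_vx_end (hμ : 0 < μ) (hγ : 0 < γ) {T : ℝ} (hT : 0 < T)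
    {m : ℝ → BallState} (h : IsMotion μ γ T u m) :
    ∃ W, Tendsto (fun t => (m t).vx) (𝓝[<] T) (𝓝 W) := by
  rcases h.phase_end hμ hγ hT with hp | hp
  · exact ⟨0, tendsto_const_nhds.congr' (hp.mono fun t ht => ht.2.1.symm)⟩
  · obtain ⟨M, hM, hb⟩ := h.exists_bound hμ hγ
    obtain ⟨a, ha, ha'⟩ := mem_nhdsLT_iff_exists_Ioo_subset.1 hp
    obtain ⟨c, hc1, hc2⟩ := exists_between (max_lt ha hT)
    have hac : a < c := (le_max_left _ _).trans_lt hc1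
    have hc0 : 0 < c := (le_max_right _ _).trans_lt hc1
    refine exists_tendsto_left_of_lipschitz (K := γ + 1 / 2 + M + 2 * μ * M) (by positivity)
      (fun s t h1 h2 h3 => abs_sub_le_of_rightDeriv (φ := fun t => (m t).vx)
        (φ' := fun t => (m t).lowerAccel μ γ) h2
        (fun r h4 h5 => ⟨?_, ?_⟩) (fun r h4 h5 => ?_)) hc2
    · have : FlightAt μ γ m r := ha' ⟨hac.trans_le (h1.trans h4), h5.trans h3⟩
      exact this.2.2.1.hasDerivWithinAt
    · obtain ⟨b1, b2, b3, b4⟩ := hb r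
        (mem_timeDomain_coe.2 ⟨hc0.le.trans (h1.trans h4), h5.trans h3⟩)
      exact BallState.abs_lowerAccel_le hμ hγ b1 b2 b3 b4
    · have : FlightAt μ γ m r := ha' ⟨hac.trans_le (h1.trans h4.le), h5.trans_lt h3⟩
      exact this.2.2.1.continuousAt.continuousWithinAt

/-- Every motion on a bounded time interval can be extended. -/
lemma IsMotion.exists_extension (hμ : 0 < μ) (hγ : 0 < γ) {T : ℝ} (hT : 0 < T)
    {m : ℝ → BallState} (h : IsMotion μ γ T u m) :
    ∃ T' : ℝ, T < T' ∧ ∃ m', IsMotion μ γ T' u m' := by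
  obtain ⟨X, Y, V, hX, hY, hV⟩ := h.exists_tendsto_end hμ hγ hT
  obtain ⟨W, hW⟩ := h.exists_tendsto_vx_end hμ hγ hT
  have hX0 : 0 ≤ X := by
    refine ge_of_tendsto hX ?_
    filter_upwards [Ioo_mem_nhdsLT hT] with t ht using (h.germRight_coe ht.1.le ht.2).nonneg
  -- With a positive limit velocity, `x` would increase from a nonnegative value and could not tend
  -- to zero.
  have hW0 : X = 0 → W ≤ 0 := by
    intro hX1
    by_contra! hcon
    obtain ⟨a, ha, ha'⟩ := mem_nhdsLT_iff_exists_Ioo_subset.1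
      (hW.eventually (lt_mem_nhds (by linarith : W / 2 < W)))
    obtain ⟨c, hc1, hc2⟩ := exists_between (max_lt ha hT)
    have hac : a < c := (le_max_left _ _).trans_lt hc1
    have hc0 : 0 < c := (le_max_right _ _).trans_lt hc1
    have h1 : Tendsto (fun t => (m c).x + W / 2 * (t - c)) (𝓝[<] T)
        (𝓝 ((m c).x + W / 2 * (T - c))) :=
      (by fun_prop : Continuous fun t : ℝ => (m c).x + W / 2 * (t - c)).continuousWithinAt
    have h2 := le_of_tendsto_of_tendsto h1 hX (by
      filter_upwards [Ioo_mem_nhdsLT hc2] with t ht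
      exact h.x_add_le hc0.le ht.1.le ht.2 fun r h4 h5 =>
        (show W / 2 < (m r).vx from ha' ⟨hac.trans_le h4, h5.trans ht.2⟩).le)
    have h3 := (h.germRight_coe hc0.le hc2).nonneg
    have : 0 < W / 2 * (T - c) := mul_pos (by linarith) (by linarith)
    linarith
  -- The motion restarts from its limit state at `T`, with `vx` reflected if this state is on the
  -- floor.
  obtain ⟨m₁, b, hb, hm0, hr, hm⟩ := exists_right (μ := μ) hγ
    (u := ⟨X, if X = 0 then -W else W, Y, V⟩) hX0
    (fun h => by simp only at h ⊢; rw [if_pos h]; linarith [hW0 h]) T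
  set m' : ℝ → BallState := fun t => if t < T then m t else m₁ t with hm'
  have hlt : ∀ t, t < T → m' t = m t := fun t ht => if_pos ht
  have hge : ∀ t, T ≤ t → m' t = m₁ t := fun t ht => if_neg (not_lt.2 ht)
  refine ⟨b, hb, m', isMotion_iff_germs.2 ⟨by rw [hlt 0 hT, h.init], fun t ht => ?_⟩⟩
  rw [mem_timeDomain_coe] at ht
  rcases lt_trichotomy t T with h1 | h1 | h1
  · have he : m' =ᶠ[𝓝 t] m := by filter_upwards [Iio_mem_nhds h1] with s hs using hlt s hs
    exact ⟨(h.germRight_coe ht.1 h1).congr (hlt t h1) (mem_nhdsWithin_of_mem_nhds he),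
      fun h0 => (h.germLeft_coe h0 h1).congr (hlt t h1) (mem_nhdsWithin_of_mem_nhds he)⟩
  · subst h1
    have heR : m' =ᶠ[𝓝[>] t] m₁ := by
      filter_upwards [self_mem_nhdsWithin] with s hs using hge s (le_of_lt hs)
    have heL : m' =ᶠ[𝓝[<] t] m := by
      filter_upwards [self_mem_nhdsWithin] with s hs using hlt s hs
    refine ⟨hr.congr (hge t le_rfl) heR, fun _ => ?_⟩
    have hmt : m' t = ⟨X, if X = 0 then -W else W, Y, V⟩ := by rw [hge t le_rfl, hm0]
    refine ⟨?_, ?_, ?_, ?_, ?_, eventually_contact_congr_left heL (h.phase_end hμ hγ hT)⟩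
    · rw [hmt]; exact hX.congr' (heL.mono fun s hs => by simp only [hs])
    · rw [hmt]; exact hY.congr' (heL.mono fun s hs => by simp only [hs])
    · rw [hmt]; exact hV.congr' (heL.mono fun s hs => by simp only [hs])
    · rw [hmt]; intro hx
      rw [if_neg (ne_of_gt hx)]
      exact hW.congr' (heL.mono fun s hs => by simp only [hs])
    · rw [hmt]; intro hx
      rw [if_pos hx, neg_neg]
      exact hW.congr' (heL.mono fun s hs => by simp only [hs])
  · have he : m' =ᶠ[𝓝 t] m₁ := by
      filter_upwards [Ioi_mem_nhds h1] with s hs using hge s (le_of_lt hs)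
    exact ⟨(hm t ⟨h1, ht.2⟩).1.congr (hge t h1.le) (mem_nhdsWithin_of_mem_nhds he),
      fun h0 => (hm t ⟨h1, ht.2⟩).2.congr (hge t h1.le) (mem_nhdsWithin_of_mem_nhds he)⟩

/-- Motions on shorter time intervals can be glued. -/
lemma exists_motion_of_forall_lt (hμ : 0 < μ) {T : EReal} (hT : 0 < T)
    (h : ∀ t ∈ timeDomain T, ∃ S : ℝ, t < S ∧ ∃ m, IsMotion μ γ S u m) :
    ∃ m, IsMotion μ γ T u m := by
  have : Inhabited BallState := ⟨u⟩
  choose! S hS M hM using h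
  have hagree : ∀ t ∈ timeDomain T, ∀ s, 0 ≤ s → s < S t → s ∈ timeDomain T →
      M s s = M t s := by
    intro t ht s h0 h1 hs
    exact (hM s hs).eq hμ (hM t ht) (mem_timeDomain_coe.2 ⟨h0, hS s hs⟩)
      (mem_timeDomain_coe.2 ⟨h0, h1⟩)
  have h0 : (0 : ℝ) ∈ timeDomain T := ⟨le_rfl, by simpa using hT⟩
  -- The diagonal is a motion because, near each `t`, it agrees with the single motion `M t` by
  -- uniqueness.
  refine ⟨fun t => M t t, isMotion_iff_germs.2 ⟨(hM 0 h0).init, fun t ht => ?_⟩⟩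
  have ht' : t ∈ timeDomain (S t : EReal) := mem_timeDomain_coe.2 ⟨ht.1, hS t ht⟩
  constructor
  · refine ((hM t ht).germRight ht').congr rfl ?_
    filter_upwards [timeDomain_mem_nhdsGT ht, Ioo_mem_nhdsGT (hS t ht)] with s h1 h2
    exact hagree t ht s h1.1 h2.2 h1
  · intro hpos
    refine ((hM t ht).germLeft ht' hpos).congr rfl ?_
    filter_upwards [timeDomain_mem_nhdsLT ht hpos, Ioo_mem_nhdsLT hpos] with s h1 h2
    exact hagree t ht s h1.1 (h2.2.trans (hS t ht)) h1

/-- Motions exist for all times. -/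
lemma exists_motion_top (hμ : 0 < μ) (hγ : 0 < γ) (hu : 0 ≤ u.x) :
    ∃ m, IsMotion μ γ ⊤ u m := by
  set S : Set ℝ := {T | 0 < T ∧ ∃ m, IsMotion μ γ T u m} with hS
  have hne : S.Nonempty := exists_motion_short hγ hu
  -- If the lifespans were bounded, gluing would give a motion up to their supremum, and extending
  -- it would exceed the supremum.
  by_cases hbdd : BddAbove S
  · exfalso
    have hpos : 0 < sSup S := by
      obtain ⟨T, hT⟩ := hne
      exact hT.1.trans_le (le_csSup hbdd hT)
    obtain ⟨m, hm⟩ := exists_motion_of_forall_lt (γ := γ) (u := u) hμ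
      (T := ((sSup S : ℝ) : EReal)) (by exact_mod_cast hpos) (fun t ht => by
        obtain ⟨T, hT, htT⟩ := exists_lt_of_lt_csSup hne (mem_timeDomain_coe.1 ht).2
        exact ⟨T, htT, hT.2⟩)
    obtain ⟨T', hT', hm'⟩ := hm.exists_extension hμ hγ hpos
    exact absurd (le_csSup hbdd ⟨hpos.trans hT', hm'⟩) (not_le.2 hT')
  · refine exists_motion_of_forall_lt hμ (EReal.coe_lt_top 0) (fun t _ => ?_)
    rw [not_bddAbove_iff] at hbdd
    obtain ⟨T, hT, htT⟩ := hbdd t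
    exact ⟨T, htT, hT.2⟩

end Extension

/-! ### The equilibrium and the theorem -/

/-- A constant motion cannot be in flight, since the two accelerations add up to `-2γ ≠ 0`. In
contact, vanishing velocity and acceleration of the upper mass fix `y`; there `F = -2γ < 0`, so the
state does stick. -/
lemma isStaticEquilibrium_iff {μ γ : ℝ} (hγ : 0 < γ) (u : BallState) :
    IsStaticEquilibrium μ γ u ↔ u = ⟨0, 0, 1 - 2 * γ, 0⟩ := by
  constructor
  · intro h
    have hp := h.right_phase 0 (mem_timeDomain_top.2 le_rfl)
    rcases hp with ⟨-, hp⟩ | ⟨-, hp⟩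
    · obtain ⟨s, h1, h2, h3, h4⟩ := hp.exists
      have h5 := h3.unique (hasDerivAt_const s u.y)
      have h6 := h4.unique (hasDerivAt_const s u.vy)
      simp only [BallState.upperAccel] at *
      ext
      · exact h1
      · exact h2
      · simp only; rw [h1, h2, h5] at h6; linarith
      · exact h5
    · exfalso
      obtain ⟨s, h1, h2, h3, h4, h5⟩ := hp.exists
      have h6 := h3.unique (hasDerivAt_const s u.vx)
      have h7 := h5.unique (hasDerivAt_const s u.vy)
      simp only [BallState.upperAccel, BallState.lowerAccel] at *
      linarith
  · rintro rfl
    refine isMotion_iff_germs.2 ⟨by simp [BallState.afterImpact], fun t _ => ?_⟩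
    have h := germs_of_eventually_contact (μ := μ) (γ := γ) (t := t)
      (m := fun _ => (⟨0, 0, 1 - 2 * γ, 0⟩ : BallState))
      (Eventually.of_forall fun s => ⟨rfl, rfl, hasDerivAt_const _ _,
        (hasDerivAt_const _ _).congr_deriv (by simp only [BallState.upperAccel]; ring)⟩)
      ⟨rfl, rfl, Or.inl (by simp only [BallState.contactForce]; linarith)⟩
    exact ⟨h.1, fun _ => h.2⟩

theorem theorem3 (μ γ : ℝ) (hμ : 0 < μ) (hγ : 0 < γ) :
    (∀ u : BallState, IsStaticEquilibrium μ γ u ↔ u = ⟨0, 0, 1 - 2 * γ, 0⟩) ∧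
    ∀ u₀ : BallState, 0 ≤ u₀.x →
      ∃ m : ℝ → BallState,
        IsMotion μ γ ⊤ u₀ m ∧
        (∀ (T : EReal) (m' : ℝ → BallState), IsMotion μ γ T u₀ m' →
          ∀ t ∈ timeDomain T, m' t = m t) ∧
        Tendsto (fun t => (m t).x) atTop (𝓝 0) ∧
        Tendsto (fun t => (m t).vx) atTop (𝓝 0) ∧
        Tendsto (fun t => (m t).y) atTop (𝓝 (1 - 2 * γ)) ∧
        Tendsto (fun t => (m t).vy) atTop (𝓝 0) := by
  refine ⟨isStaticEquilibrium_iff hγ, fun u₀ hu => ?_⟩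
  obtain ⟨m, hm⟩ := exists_motion_top hμ hγ hu
  exact ⟨m, hm, fun T m' hm' t ht => hm'.eq hμ hm ht (mem_timeDomain_top.2 ht.1),
    hm.tendsto_x hμ hγ, hm.tendsto_vx hμ hγ, hm.tendsto_y hμ hγ, hm.tendsto_vy hμ hγ⟩
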